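/- **Setting.** Let $l\ge 1$ and consider the AR system $$y(t)+\sum_{i=1}^{l}A_i y(t-i)=\sum_{i=0}^{l}B_{ui}u(t-i)+\sum_{i=0}^{l}B_{wi}w(t-i)+B_{d0}d(t),$$ with $y(t)\in\mathbb R^p$, $u(t)\in\mathbb R^m$, $w(t)\in\mathbb R^{m_w}$, $d(t)\in\mathbb R^{m_d}$ and $B_{d0}$ of full column rank. Put $\chi(t)=\mathrm{col}(y(t-1),\dots,y(t-l),u(t-1),\dots,u(t-l),w(t-1),\dots,w(t-l))$, and let $J_A,J_B,J_{B_1}$ be the constant $0/1$ matrices for which every trajectory satisfies $\chi(t+1)=\mathrm{col}\big(y(t),\,J_A\chi(t)+J_Bu(t)+J_{B_1}w(t)\big)$. Let a trajectory of the system be recorded, with data matrices $Y=(y(0)\cdots y(N-1))$, $X=(\chi(0)\cdots\chi(N-1))$, $U_{\rm dat}=(u(0)\cdots u(N-1))$, $W=(w(0)\cdots w(N-1))$, and let $W_d=(d(0)\cdots d(N-1))$. Let $X=X_s\Sigma_\chi X_r^\top$ be a compact singular value decomposition with $\tilde n=\operatorname{rank}X$ columns in $X_s$, let $X_d=\Sigma_\chi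 X_r^\top$, and let $X_s=\mathrm{col}(X_{s1},X_{s2})$ where $X_{s1}$ has $p$ rows. Let $\Phi=\Phi^\top=\begin{pmatrix}\Phi_{11}&\Phi_{12}\\ \Phi_{12}^\top&\Phi_{22}\end{pmatrix}\in\mathbb R^{(m_d+N)\times(m_d+N)}$ with $\Phi_{22}\prec0$, and let $$\Sigma=\Big\{(\bar A_s,B_{u0},B_{w0}) : Y=\bar A_sX_d+B_{u0}U_{\rm dat}+B_{w0}W+B_{d0}\Omega\ \text{ for some }\Omega\text{ with }\begin{pmatrix}I\\ \Omega^\top\end{pmatrix}^{\!\top}\!\Phi\begin{pmatrix}I\\ \Omega^\top\end{pmatrix}\succeq0\Big\}.$$ Assume: 1. starting from the recorded past, $\chi(t)\in\operatorname{im}X$ for all $t\ge 0$ and all inputs $u,w,d$; 2. the first $p$ rows of $X$ are linearly independent; 3. $\Omega=W_d$ satisfies the inequality in the definition of $\Sigma$; 4. $\Sigma\neq\emptyset$ and $\operatorname{rank}\mathrm{col}(X_d,U_{\rm dat},W)=\tilde n+m+m_w$. For a triple in $\Sigma$ let $A=X_s^\top\mathrm{col}(\bar A_s,J_AX_s)$,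 $B=X_s^\top\mathrm{col}(B_{u0},J_B)$, $B_1=X_s^\top\mathrm{col}(B_{w0},J_{B_1})$. Let $z=\hat C_1\chi+Eu+D_1w\in\mathbb R^{p_z}$, $y_c=\hat C\chi$, $C_1=\hat C_1X_s$, $C=\hat CX_s$. For a controller $x_c(t+1)=A_cx_c(t)+B_cy_c(t)$, $u(t)=C_cx_c(t)+D_cy_c(t)$ with $x_c(t)\in\mathbb R^{\tilde n}$ let $$\tilde A=\begin{pmatrix}A+BD_cC&BC_c\\B_cC&A_c\end{pmatrix},\quad \tilde B=\begin{pmatrix}B_1\\0\end{pmatrix},\quad \tilde C=\begin{pmatrix}C_1+ED_cC&EC_c\end{pmatrix},\quad \tilde D=D_1 .$$ Let $Q=Q^\top$, $S$ and $R\succeq0$ be given, with $R=T\tilde RT^\top$, $\tilde R\in\mathbb R^{\tilde p_z\times\tilde p_z}$, $\tilde R\succ0$. Let $$H=F\Phi F^\top,\qquad F=\begin{pmatrix}B_{d0}&Y\\0&-G\end{pmatrix},\qquad G=\mathrm{col}(X_d,U_{\rm dat},W),$$ partitioned into blocks $H_{ij}$, $i,j=1,\dots,4$, of sizes $p,\tilde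 n,m,m_w$; put $\mathcal H=(H_{ij})_{i,j\ge2}$, $\mathcal H_1=\mathrm{col}(H_{12}^\top,H_{13}^\top,H_{14}^\top)$, and $$(\check A_s\ \check B_{u0}\ \check B_{w0})^\top=-\mathcal H^{-1}\mathcal H_1,\qquad \bar{\mathcal H}=\mathcal H_1+\mathcal H(\check A_s\ \check B_{u0}\ \check B_{w0})^\top .$$ Let $\check A,\check B,\check B_1$ be $A,B,B_1$ evaluated at $(\check A_s,\check B_{u0},\check B_{w0})$. Let $\Lambda\in\mathbb R^{\tilde p\times\tilde p}$, $\Lambda\succ0$, and $\Xi$ satisfy $(I\ \check A_s\ \check B_{u0}\ \check B_{w0})H(I\ \check A_s\ \check B_{u0}\ \check B_{w0})^\top=\Xi\Lambda\Xi^\top$. Let $L=\mathrm{col}(L_1,L_2)$, where the columns of $L_1^\top$ form a basis of $\ker X_{s1}$ and $L_2=(X_{s1}X_{s1}^\top)^{-1}X_{s1}$. For a scalar $\alpha$, symmetric $\bar X,\bar Y\in\mathbb R^{\tilde n\times\tilde n}$ and matrices $\tilde A_c,\tilde B_c,\tilde C_c,D_c$ let $\Pi=\begin{pmatrix}\Pi_{11}&\Pi_{12}\\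 \Pi_{12}^\top&\Pi_{22}\end{pmatrix}$, where ($\star$ denotes blocks determined by symmetry) $$\Pi_{11}=\begin{pmatrix}\bar X&I&\star&\star\\ I&\bar Y&\star&\star\\ -S(C_1+ED_cC)&-S(C_1\bar Y+E\tilde C_c)&-Q-SD_1-(SD_1)^\top&\star\\ T^\top(C_1+ED_cC)&T^\top(C_1\bar Y+E\tilde C_c)&T^\top D_1&\tilde R^{-1}\end{pmatrix},$$ $$\Pi_{12}^\top=\begin{pmatrix}\check A+\check BD_cC&\check A\bar Y+\check B\tilde C_c&\check B_1&0\\ \bar X\check A+\tilde B_cC&\tilde A_c&\bar X\check B_1&0\\ I&\bar Y&0&0\\ D_cC&\tilde C_c&0&0\\ 0&0&I&0\\ 0_{\tilde p\times\tilde n}&0&0&0\end{pmatrix},$$ $$\Pi_{22}=\begin{pmatrix}\bar Y&I&\star&\star\\ I&\bar X&\star&\star\\ (0\ \ {-\alpha}\bar{\mathcal H})L^{-\top}&(0\ \ {-\alpha}\bar{\mathcal H})L^{-\top}\bar X&-\alpha\mathcal H&\star\\ (0\ \ \alpha\Xi^\top)L^{-\top}&(0\ \ \alpha\Xi^\top)L^{-\top}\bar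 X&0&\alpha\Lambda^{-1}\end{pmatrix}$$ (the third block row of $\Pi_{22}$ collects the rows of sizes $\tilde n,m,m_w$). **Theorem.** The following two statements are equivalent. (i) There are controller matrices $A_c,B_c,C_c,D_c$ and a matrix $P\succ0$ such that for all $(\bar A_s,B_{u0},B_{w0})\in\Sigma$ $$\begin{pmatrix}I&0\\ \tilde A&\tilde B\\0&I\\ \tilde C&\tilde D\end{pmatrix}^{\!\top}\begin{pmatrix}-P&0&0&0\\0&P&0&0\\0&0&Q&S\\0&0&S^\top&R\end{pmatrix}\begin{pmatrix}I&0\\ \tilde A&\tilde B\\0&I\\ \tilde C&\tilde D\end{pmatrix}\prec0 .$$ (ii) $\Pi\succ0$ for some real $\alpha$, symmetric $\bar X,\bar Y$ and matrices $\tilde A_c,\tilde B_c,\tilde C_c,D_c$. Moreover, for every solution of $\Pi\succ0$ and every invertible $U\in\mathbb R^{\tilde n\times\tilde n}$, the matrix $V^\top=U^{-1}(I-\bar X\bar Y)$ is invertible, and the controller given by $D_c$ and $$B_c=U^{-1}(\tilde B_c-\bar X\check BD_c),\qquad C_c=(\tilde C_c-D_cC\bar Y)V^{-\top},$$ $$A_c=U^{-1}\big(\tilde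 A_c-\bar X(\check A\bar Y+\check B\tilde C_c)-UB_cC\bar Y\big)V^{-\top}$$ satisfies (i) with some $P\succ0$. -/

import Mathlib

open Matrix

namespace DDSynth

/-! ### Autoregressive model, trajectories and the extended state -/

/-- Coefficients of the AR model
`y(t) + ∑_{i=1}^l A_i y(t-i) = ∑_{i=0}^l Bu_i u(t-i) + ∑_{i=0}^l Bw_i w(t-i) + Bd0 d(t)`.
For lag `l` only the entries `A 1, …, A l`, `Bu 0, …, Bu l`, `Bw 0, …, Bw l` are used. -/
structure ARModel (p m q md : ℕ) where
  A : ℕ → Matrix (Fin p) (Fin p) ℝ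
  Bu : ℕ → Matrix (Fin p) (Fin m) ℝ
  Bw : ℕ → Matrix (Fin p) (Fin q) ℝ
  Bd0 : Matrix (Fin p) (Fin md) ℝ

/-- The signals: output `y`, control input `u`, disturbance `w` of the performance channel,
noise `d`. -/
structure Signals (p m q md : ℕ) where
  y : ℤ → Fin p → ℝ
  u : ℤ → Fin m → ℝ
  w : ℤ → Fin q → ℝ
  d : ℤ → Fin md → ℝ

/-- The AR equation with lag `l` holds at time `t`. -/
def ARModel.HoldsAt {p m q md : ℕ} (M : ARModel p m q md) (l : ℕ) (s : Signals p m q md)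
    (t : ℤ) : Prop :=
  s.y t + ∑ i ∈ Finset.Icc 1 l, M.A i *ᵥ s.y (t - i) =
    (∑ i ∈ Finset.range (l + 1), M.Bu i *ᵥ s.u (t - i)) +
    (∑ i ∈ Finset.range (l + 1), M.Bw i *ᵥ s.w (t - i)) + M.Bd0 *ᵥ s.d t

/-- Coordinates of the extended state below the first `p` ones:
`y(t-2), …, y(t-l)`, then `u(t-1), …, u(t-l)`, then `w(t-1), …, w(t-l)`. -/
abbrev RestIdx (l p m q : ℕ) : Type :=
  (Fin (l - 1) × Fin p) ⊕ ((Fin l × Fin m) ⊕ (Fin l × Fin q))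

/-- Coordinates of the extended state
`χ(t) = col(y(t-1), …, y(t-l), u(t-1), …, u(t-l), w(t-1), …, w(t-l))`;
the first summand is `y(t-1)`. -/
abbrev StateIdx (l p m q : ℕ) : Type := Fin p ⊕ RestIdx l p m q

/-- The delay of the signal sample stored in a coordinate of the extended state. -/
def delay {l p m q : ℕ} : StateIdx l p m q → ℕ
  | .inl _ => 1
  | .inr (.inl (i, _)) => i + 2
  | .inr (.inr (.inl (i, _))) => i + 1
  | .inr (.inr (.inr (i, _))) => i + 1

/-- The scalar channel (component of `y`, of `u` or of `w`) stored in a coordinate of the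
extended state. -/
def channel {l p m q : ℕ} : StateIdx l p m q → Fin p ⊕ (Fin m ⊕ Fin q)
  | .inl a => .inl a
  | .inr (.inl (_, a)) => .inl a
  | .inr (.inr (.inl (_, b))) => .inr (.inl b)
  | .inr (.inr (.inr (_, c))) => .inr (.inr c)

/-- The extended state `χ(t)`. -/
def stateVec {p m q md : ℕ} (l : ℕ) (s : Signals p m q md) (t : ℤ) : StateIdx l p m q → ℝ :=
  fun k => Sum.elim (s.y (t - delay k)) (Sum.elim (s.u (t - delay k)) (s.w (t - delay k)))
    (channel k)

/-- `J_A`: the known shift part of the state matrix. -/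
def JA (l p m q : ℕ) : Matrix (RestIdx l p m q) (StateIdx l p m q) ℝ :=
  Matrix.of fun r c =>
    if channel (.inr r : StateIdx l p m q) = channel c ∧
        delay (.inr r : StateIdx l p m q) = delay c + 1 then 1 else 0

/-- `J_B`: the input `u(t)` enters the coordinates that store `u` with delay one. -/
def JB (l p m q : ℕ) : Matrix (RestIdx l p m q) (Fin m) ℝ :=
  Matrix.of fun r b =>
    if channel (.inr r : StateIdx l p m q) = .inr (.inl b) ∧
        delay (.inr r : StateIdx l p m q) = 1 then 1 else 0

/-- `J_{B_1}`: the input `w(t)` enters the coordinates that store `w` with delay one. -/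
def JB1 (l p m q : ℕ) : Matrix (RestIdx l p m q) (Fin q) ℝ :=
  Matrix.of fun r c =>
    if channel (.inr r : StateIdx l p m q) = .inr (.inr c) ∧
        delay (.inr r : StateIdx l p m q) = 1 then 1 else 0

/-! ### Recorded data -/

/-- `Y = (y(0) … y(N-1))`. -/
def dataY {p m q md : ℕ} (N : ℕ) (s : Signals p m q md) : Matrix (Fin p) (Fin N) ℝ :=
  Matrix.of fun a t => s.y (t : ℕ) a

/-- `X = (χ(0) … χ(N-1))`. -/
def dataX {p m q md : ℕ} (l N : ℕ) (s : Signals p m q md) :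
    Matrix (StateIdx l p m q) (Fin N) ℝ :=
  Matrix.of fun k t => stateVec l s (t : ℕ) k

/-- `U = (u(0) … u(N-1))`. -/
def dataU {p m q md : ℕ} (N : ℕ) (s : Signals p m q md) : Matrix (Fin m) (Fin N) ℝ :=
  Matrix.of fun b t => s.u (t : ℕ) b

/-- `W = (w(0) … w(N-1))`. -/
def dataW {p m q md : ℕ} (N : ℕ) (s : Signals p m q md) : Matrix (Fin q) (Fin N) ℝ :=
  Matrix.of fun c t => s.w (t : ℕ) c

/-- `W_d = (d(0) … d(N-1))`. -/
def dataD {p m q md : ℕ} (N : ℕ) (s : Signals p m q md) : Matrix (Fin md) (Fin N) ℝ :=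
  Matrix.of fun c t => s.d (t : ℕ) c

/-- Whatever inputs `u, w, d` are applied from time `0` on, starting from the recorded past,
the extended state never leaves the column space of the recorded state data matrix. -/
def StateStaysInData {p m q md : ℕ} (M : ARModel p m q md) (l N : ℕ)
    (s : Signals p m q md) : Prop :=
  ∀ s' : Signals p m q md,
    (∀ t : ℤ, t < 0 → s'.y t = s.y t ∧ s'.u t = s.u t ∧ s'.w t = s.w t) →
    (∀ t : ℤ, 0 ≤ t → M.HoldsAt l s' t) →
    ∀ t : ℤ, 0 ≤ t → stateVec l s' t ∈ LinearMap.range (dataX l N s).mulVecLin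

/-- `X = X_s diag(σ) X_rᵀ` is a compact singular value decomposition. -/
def IsCompactSVD {ι : Type*} [Fintype ι] [DecidableEq ι] {N n : ℕ} (X : Matrix ι (Fin N) ℝ)
    (Xs : Matrix ι (Fin n) ℝ) (σ : Fin n → ℝ) (Xr : Matrix (Fin N) (Fin n) ℝ) : Prop :=
  Xsᵀ * Xs = 1 ∧ Xrᵀ * Xr = 1 ∧ (∀ i, 0 < σ i) ∧ X = Xs * Matrix.diagonal σ * Xrᵀ

/-- The quadratic matrix inequality bounding the noise data. -/
def NoiseBound {md N : ℕ} (Φ : Matrix (Fin md ⊕ Fin N) (Fin md ⊕ Fin N) ℝ)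
    (Wd : Matrix (Fin md) (Fin N) ℝ) : Prop :=
  ((fromRows (1 : Matrix (Fin md) (Fin md) ℝ) Wdᵀ)ᵀ * Φ *
    fromRows (1 : Matrix (Fin md) (Fin md) ℝ) Wdᵀ).PosSemidef

/-- The set `Σ` of triples `(Ā_s, B_{u0}, B_{w0})` consistent with the data. -/
def consistentSet {p m q md N n : ℕ} (Bd0 : Matrix (Fin p) (Fin md) ℝ)
    (Φ : Matrix (Fin md ⊕ Fin N) (Fin md ⊕ Fin N) ℝ)
    (Y : Matrix (Fin p) (Fin N) ℝ) (Xd : Matrix (Fin n) (Fin N) ℝ)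
    (U : Matrix (Fin m) (Fin N) ℝ) (W : Matrix (Fin q) (Fin N) ℝ) :
    Set (Matrix (Fin p) (Fin n) ℝ × Matrix (Fin p) (Fin m) ℝ × Matrix (Fin p) (Fin q) ℝ) :=
  {τ | ∃ Wd : Matrix (Fin md) (Fin N) ℝ, NoiseBound Φ Wd ∧
    Y = τ.1 * Xd + τ.2.1 * U + τ.2.2 * W + Bd0 * Wd}

/-! ### Reduced realization and closed loop -/

/-- `A = X_sᵀ col(Ā_s, J_A X_s)`. -/
def redA {l p m q n : ℕ} (Xs : Matrix (StateIdx l p m q) (Fin n) ℝ)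
    (As : Matrix (Fin p) (Fin n) ℝ) : Matrix (Fin n) (Fin n) ℝ :=
  Xsᵀ * fromRows As (JA l p m q * Xs)

/-- `B = X_sᵀ col(B_{u0}, J_B)`. -/
def redB {l p m q n : ℕ} (Xs : Matrix (StateIdx l p m q) (Fin n) ℝ)
    (Bu0 : Matrix (Fin p) (Fin m) ℝ) : Matrix (Fin n) (Fin m) ℝ :=
  Xsᵀ * fromRows Bu0 (JB l p m q)

/-- `B_1 = X_sᵀ col(B_{w0}, J_{B_1})`. -/
def redB1 {l p m q n : ℕ} (Xs : Matrix (StateIdx l p m q) (Fin n) ℝ)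
    (Bw0 : Matrix (Fin p) (Fin q) ℝ) : Matrix (Fin n) (Fin q) ℝ :=
  Xsᵀ * fromRows Bw0 (JB1 l p m q)

/-- The outer factor with block rows `(I 0)`, `(A B)`, `(0 I)`, `(C D)`. -/
def dissOuter {ι : Type*} [DecidableEq ι] {q pz : ℕ}
    (A : Matrix ι ι ℝ) (B : Matrix ι (Fin q) ℝ) (C : Matrix (Fin pz) ι ℝ)
    (D : Matrix (Fin pz) (Fin q) ℝ) :
    Matrix ((ι ⊕ ι) ⊕ (Fin q ⊕ Fin pz)) (ι ⊕ Fin q) ℝ :=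
  fromRows (fromBlocks 1 0 A B) (fromBlocks 0 1 C D)

/-- The strict dissipation inequality of the system `(A, B, C, D)` with storage matrix `P` for
the supply function with matrix `-(Q S; Sᵀ R)`. -/
def DissipationIneq {ι : Type*} [Fintype ι] [DecidableEq ι] {q pz : ℕ}
    (A : Matrix ι ι ℝ) (B : Matrix ι (Fin q) ℝ) (C : Matrix (Fin pz) ι ℝ)
    (D : Matrix (Fin pz) (Fin q) ℝ) (Q : Matrix (Fin q) (Fin q) ℝ)
    (S : Matrix (Fin q) (Fin pz) ℝ) (R : Matrix (Fin pz) (Fin pz) ℝ)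
    (P : Matrix ι ι ℝ) : Prop :=
  (-((dissOuter A B C D)ᵀ *
      fromBlocks (fromBlocks (-P) 0 0 P) 0 0 (fromBlocks Q S Sᵀ R) *
      dissOuter A B C D)).PosDef

/-- The controller `(Ac, Bc, Cc, Dc)` and the certificate `P` satisfy `P ≻ 0` and the strict
dissipation inequality of the closed loop for every triple in the set `Sig`. -/
def RobustDissipative {l p m q n pc pz : ℕ} (Xs : Matrix (StateIdx l p m q) (Fin n) ℝ)
    (Sig : Set (Matrix (Fin p) (Fin n) ℝ × Matrix (Fin p) (Fin m) ℝ × Matrix (Fin p) (Fin q) ℝ))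
    (C : Matrix (Fin pc) (Fin n) ℝ) (C1 : Matrix (Fin pz) (Fin n) ℝ)
    (E : Matrix (Fin pz) (Fin m) ℝ) (D1 : Matrix (Fin pz) (Fin q) ℝ)
    (Q : Matrix (Fin q) (Fin q) ℝ) (S : Matrix (Fin q) (Fin pz) ℝ)
    (R : Matrix (Fin pz) (Fin pz) ℝ)
    (Ac : Matrix (Fin n) (Fin n) ℝ) (Bc : Matrix (Fin n) (Fin pc) ℝ)
    (Cc : Matrix (Fin m) (Fin n) ℝ) (Dc : Matrix (Fin m) (Fin pc) ℝ)
    (P : Matrix (Fin n ⊕ Fin n) (Fin n ⊕ Fin n) ℝ) : Prop :=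
  P.PosDef ∧ ∀ τ ∈ Sig,
    DissipationIneq
      (fromBlocks (redA Xs τ.1 + redB Xs τ.2.1 * Dc * C) (redB Xs τ.2.1 * Cc) (Bc * C) Ac)
      (fromRows (redB1 Xs τ.2.2) 0)
      (fromCols (C1 + E * Dc * C) (E * Cc))
      D1 Q S R P

/-! ### Matrices of the synthesis inequality -/

/-- The matrix `H`, partitioned as `p + (n + m + q)`. -/
def matH {p m q md N n : ℕ} (Bd0 : Matrix (Fin p) (Fin md) ℝ)
    (Φ : Matrix (Fin md ⊕ Fin N) (Fin md ⊕ Fin N) ℝ)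
    (Y : Matrix (Fin p) (Fin N) ℝ) (Xd : Matrix (Fin n) (Fin N) ℝ)
    (U : Matrix (Fin m) (Fin N) ℝ) (W : Matrix (Fin q) (Fin N) ℝ) :
    Matrix (Fin p ⊕ (Fin n ⊕ (Fin m ⊕ Fin q))) (Fin p ⊕ (Fin n ⊕ (Fin m ⊕ Fin q))) ℝ :=
  fromBlocks Bd0 Y 0 (-fromRows Xd (fromRows U W)) * Φ *
    (fromBlocks Bd0 Y 0 (-fromRows Xd (fromRows U W)))ᵀ

/-- `(Ǎ_s  B̌_{u0}  B̌_{w0})ᵀ`: minus the inverse of the lower right block of `H` times the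
lower left block of `H`. -/
noncomputable def centerT {p : ℕ} {κ : Type*} [Fintype κ] [DecidableEq κ]
    (H : Matrix (Fin p ⊕ κ) (Fin p ⊕ κ) ℝ) : Matrix κ (Fin p) ℝ :=
  -(H.toBlocks₂₂⁻¹ * H.toBlocks₂₁)

/-- `col(I, Ǎ_sᵀ, B̌_{u0}ᵀ, B̌_{w0}ᵀ)`. -/
noncomputable def colCenter {p : ℕ} {κ : Type*} [Fintype κ] [DecidableEq κ]
    (H : Matrix (Fin p ⊕ κ) (Fin p ⊕ κ) ℝ) : Matrix (Fin p ⊕ κ) (Fin p) ℝ :=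
  fromRows 1 (centerT H)

/-- `Ǎ_s`. -/
noncomputable def checkAs {p m q n : ℕ}
    (H : Matrix (Fin p ⊕ (Fin n ⊕ (Fin m ⊕ Fin q))) (Fin p ⊕ (Fin n ⊕ (Fin m ⊕ Fin q))) ℝ) :
    Matrix (Fin p) (Fin n) ℝ :=
  (centerT H)ᵀ.toCols₁

/-- `B̌_{u0}`. -/
noncomputable def checkBu0 {p m q n : ℕ}
    (H : Matrix (Fin p ⊕ (Fin n ⊕ (Fin m ⊕ Fin q))) (Fin p ⊕ (Fin n ⊕ (Fin m ⊕ Fin q))) ℝ) :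
    Matrix (Fin p) (Fin m) ℝ :=
  (centerT H)ᵀ.toCols₂.toCols₁

/-- `B̌_{w0}`. -/
noncomputable def checkBw0 {p m q n : ℕ}
    (H : Matrix (Fin p ⊕ (Fin n ⊕ (Fin m ⊕ Fin q))) (Fin p ⊕ (Fin n ⊕ (Fin m ⊕ Fin q))) ℝ) :
    Matrix (Fin p) (Fin q) ℝ :=
  (centerT H)ᵀ.toCols₂.toCols₂

/-- `col(H̄₁₂ᵀ, H̄₁₃ᵀ, H̄₁₄ᵀ)`: the lower block rows of `H` times
`col(I, Ǎ_sᵀ, B̌_{u0}ᵀ, B̌_{w0}ᵀ)`. -/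
noncomputable def barHT {p : ℕ} {κ : Type*} [Fintype κ] [DecidableEq κ]
    (H : Matrix (Fin p ⊕ κ) (Fin p ⊕ κ) ℝ) : Matrix κ (Fin p) ℝ :=
  H.toRows₂ * colCenter H

/-- The two-sided inverse of a matrix whose rows and columns may be indexed by different types;
`0` if there is none. -/
noncomputable def rectInv {ι κ : Type*} [Fintype ι] [Fintype κ] [DecidableEq ι] [DecidableEq κ]
    (L : Matrix ι κ ℝ) : Matrix κ ι ℝ :=
  open Classical in if h : ∃ K : Matrix κ ι ℝ, L * K = 1 ∧ K * L = 1 then h.choose else 0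

theorem rectInv_eq {ι κ : Type*} [Fintype ι] [Fintype κ] [DecidableEq ι] [DecidableEq κ]
    {L : Matrix ι κ ℝ} {K : Matrix κ ι ℝ} (h1 : L * K = 1) (h2 : K * L = 1) :
    rectInv L = K := by
  have h : ∃ K : Matrix κ ι ℝ, L * K = 1 ∧ K * L = 1 := ⟨K, h1, h2⟩
  rw [rectInv, dif_pos h]
  calc h.choose = (K * L) * h.choose := by rw [h2, Matrix.one_mul]
    _ = K := by rw [Matrix.mul_assoc, h.choose_spec.1, Matrix.mul_one]

/-- The rows of `L1` form a basis of the kernel of `X`. -/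
def RowsBasisOfKer {r p n : ℕ} (L1 : Matrix (Fin r) (Fin n) ℝ)
    (X : Matrix (Fin p) (Fin n) ℝ) : Prop :=
  LinearIndependent ℝ L1.row ∧
    Submodule.span ℝ (Set.range L1.row) = LinearMap.ker X.mulVecLin

/-- `L = col(L_1, L_2)` with `L_2 = (X_{s1} X_{s1}ᵀ)⁻¹ X_{s1}`. -/
noncomputable def matL {r p n : ℕ} (L1 : Matrix (Fin r) (Fin n) ℝ)
    (Xs1 : Matrix (Fin p) (Fin n) ℝ) : Matrix (Fin r ⊕ Fin p) (Fin n) ℝ :=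
  fromRows L1 ((Xs1 * Xs1ᵀ)⁻¹ * Xs1)

/-- `Π₁₁`, with block rows `(n + n) + (q + p̃_z)`. -/
noncomputable def matPi11 {m q n pc pz pzt : ℕ}
    (C : Matrix (Fin pc) (Fin n) ℝ) (C1 : Matrix (Fin pz) (Fin n) ℝ)
    (E : Matrix (Fin pz) (Fin m) ℝ) (D1 : Matrix (Fin pz) (Fin q) ℝ)
    (Q : Matrix (Fin q) (Fin q) ℝ) (S : Matrix (Fin q) (Fin pz) ℝ)
    (T : Matrix (Fin pz) (Fin pzt) ℝ) (Rt : Matrix (Fin pzt) (Fin pzt) ℝ)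
    (X Y : Matrix (Fin n) (Fin n) ℝ) (Cct : Matrix (Fin m) (Fin n) ℝ)
    (Dc : Matrix (Fin m) (Fin pc) ℝ) :
    Matrix ((Fin n ⊕ Fin n) ⊕ (Fin q ⊕ Fin pzt)) ((Fin n ⊕ Fin n) ⊕ (Fin q ⊕ Fin pzt)) ℝ :=
  let G := fromBlocks
    (-(S * (C1 + E * Dc * C))) (-(S * (C1 * Y + E * Cct)))
    (Tᵀ * (C1 + E * Dc * C)) (Tᵀ * (C1 * Y + E * Cct))
  fromBlocks
    (fromBlocks X 1 1 Y) Gᵀ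
    G (fromBlocks (-Q - ((S * D1)ᵀ + S * D1)) (Tᵀ * D1)ᵀ (Tᵀ * D1) Rt⁻¹)

/-- `Π₁₂ᵀ`, with block rows `(n + n) + ((n + m + q) + p̃)` and block columns
`(n + n) + (q + p̃_z)`. -/
def matPi12T {m q n pc : ℕ} (pzt pt : ℕ)
    (C : Matrix (Fin pc) (Fin n) ℝ)
    (Ach : Matrix (Fin n) (Fin n) ℝ) (Bch : Matrix (Fin n) (Fin m) ℝ)
    (B1ch : Matrix (Fin n) (Fin q) ℝ)
    (X Y Act : Matrix (Fin n) (Fin n) ℝ) (Bct : Matrix (Fin n) (Fin pc) ℝ)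
    (Cct : Matrix (Fin m) (Fin n) ℝ) (Dc : Matrix (Fin m) (Fin pc) ℝ) :
    Matrix ((Fin n ⊕ Fin n) ⊕ ((Fin n ⊕ (Fin m ⊕ Fin q)) ⊕ Fin pt))
      ((Fin n ⊕ Fin n) ⊕ (Fin q ⊕ Fin pzt)) ℝ :=
  fromBlocks
    (fromBlocks (Ach + Bch * Dc * C) (Ach * Y + Bch * Cct) (X * Ach + Bct * C) Act)
    (fromBlocks B1ch 0 (X * B1ch) 0)
    (fromRows
      (fromRows (fromCols 1 Y) (fromRows (fromCols (Dc * C) Cct) (fromCols 0 0)))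
      0)
    (fromRows
      (fromRows (fromCols 0 0) (fromRows (fromCols 0 0) (fromCols 1 0)))
      0)

/-- `Π₂₂`, with block rows `(n + n) + ((n + m + q) + p̃)`. -/
noncomputable def matPi22 {p m q n r pt : ℕ}
    (H : Matrix (Fin p ⊕ (Fin n ⊕ (Fin m ⊕ Fin q))) (Fin p ⊕ (Fin n ⊕ (Fin m ⊕ Fin q))) ℝ)
    (L : Matrix (Fin r ⊕ Fin p) (Fin n) ℝ)
    (Ξ : Matrix (Fin p) (Fin pt) ℝ) (Λ : Matrix (Fin pt) (Fin pt) ℝ)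
    (α : ℝ) (X Y : Matrix (Fin n) (Fin n) ℝ) :
    Matrix ((Fin n ⊕ Fin n) ⊕ ((Fin n ⊕ (Fin m ⊕ Fin q)) ⊕ Fin pt))
      ((Fin n ⊕ Fin n) ⊕ ((Fin n ⊕ (Fin m ⊕ Fin q)) ⊕ Fin pt)) ℝ :=
  let F := fromCols (0 : Matrix (Fin n ⊕ (Fin m ⊕ Fin q)) (Fin r) ℝ) (-(α • barHT H)) *
    (rectInv L)ᵀ
  let F' := fromCols (0 : Matrix (Fin pt) (Fin r) ℝ) (α • Ξᵀ) * (rectInv L)ᵀ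
  let G := fromBlocks F (F * X) F' (F' * X)
  fromBlocks
    (fromBlocks Y 1 1 X) Gᵀ
    G (fromBlocks (-(α • H.toBlocks₂₂)) 0 0 (α • Λ⁻¹))

/-- The synthesis matrix `Π`. -/
noncomputable def matPi {l p m q n r pc pz pzt pt : ℕ}
    (Xs : Matrix (StateIdx l p m q) (Fin n) ℝ)
    (H : Matrix (Fin p ⊕ (Fin n ⊕ (Fin m ⊕ Fin q))) (Fin p ⊕ (Fin n ⊕ (Fin m ⊕ Fin q))) ℝ)
    (L1 : Matrix (Fin r) (Fin n) ℝ)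
    (Ξ : Matrix (Fin p) (Fin pt) ℝ) (Λ : Matrix (Fin pt) (Fin pt) ℝ)
    (C : Matrix (Fin pc) (Fin n) ℝ) (C1 : Matrix (Fin pz) (Fin n) ℝ)
    (E : Matrix (Fin pz) (Fin m) ℝ) (D1 : Matrix (Fin pz) (Fin q) ℝ)
    (Q : Matrix (Fin q) (Fin q) ℝ) (S : Matrix (Fin q) (Fin pz) ℝ)
    (T : Matrix (Fin pz) (Fin pzt) ℝ) (Rt : Matrix (Fin pzt) (Fin pzt) ℝ)
    (α : ℝ) (X Y Act : Matrix (Fin n) (Fin n) ℝ) (Bct : Matrix (Fin n) (Fin pc) ℝ)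
    (Cct : Matrix (Fin m) (Fin n) ℝ) (Dc : Matrix (Fin m) (Fin pc) ℝ) :
    Matrix (((Fin n ⊕ Fin n) ⊕ (Fin q ⊕ Fin pzt)) ⊕
        ((Fin n ⊕ Fin n) ⊕ ((Fin n ⊕ (Fin m ⊕ Fin q)) ⊕ Fin pt)))
      (((Fin n ⊕ Fin n) ⊕ (Fin q ⊕ Fin pzt)) ⊕
        ((Fin n ⊕ Fin n) ⊕ ((Fin n ⊕ (Fin m ⊕ Fin q)) ⊕ Fin pt))) ℝ :=
  let PT := matPi12T pzt pt C (redA Xs (checkAs H)) (redB Xs (checkBu0 H))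
    (redB1 Xs (checkBw0 H)) X Y Act Bct Cct Dc
  fromBlocks
    (matPi11 C C1 E D1 Q S T Rt X Y Cct Dc) PTᵀ
    PT (matPi22 H (matL L1 Xs.toRows₁) Ξ Λ α X Y)

end DDSynth

/-!
Around the center of the data ellipsoid the consistent triples are exactly the deviations `Δ` with
`Δ N Δᵀ ⪯ Ξ Λ Ξᵀ`, where `N = -𝓗 ≻ 0`, so (i) is a dissipation inequality for all
`(Ã + M Δ Eₓ, B̃ + M Δ E_w)` with `Δ` in that ellipsoid. After Schur complements this reads
`Θ + M Δ E + (M Δ E)ᵀ ≻ 0`, and Petersen's lemma removes `Δ` at the price of one scalar `α > 0`.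
The lemma reduces to quadratic forms: if `θ > 0` and `4 a c < θ²` away from `0`, then
`α θ - (α² a + c)` is positive definite for some `α > 0`. Otherwise the vectors of the unit sphere
where it fails and `α² a ≤ c`, respectively `α² a ≥ c`, give two closed sets of `α` covering
`(0, ∞)`; a common `α` of both yields a vector where `α² a = c` and `α θ ≤ 2 α² a`, against the
discriminant condition.

The matrix inequality obtained is bilinear in `P` and the controller. It becomes `Π ≻ 0` under the
congruence with `col(I, 0), col(Ȳ, Vᵀ)` built from the blocks of `P` and `P⁻¹`, followed by the
usual change of controller variables; the off-diagonal block of `P` is made invertible by a small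
perturbation of `P`.
-/

namespace DDSynth

section QuadraticForms

open Metric

theorem exists_ne_zero_eq_zero_and_nonpos {E : Type*} [AddCommGroup E] [Module ℝ E]
    {p g : QuadraticForm ℝ E} {x y : E} (hpx : p x < 0) (hpy : 0 < p y) (hgx : g x ≤ 0)
    (hgy : g y ≤ 0) : ∃ z ≠ 0, p z = 0 ∧ g z ≤ 0 := by
  have expand (f : QuadraticForm ℝ E) (t : ℝ) :
      f (x + t • y) = f x + t * QuadraticMap.polar f x y + t ^ 2 * f y := by
    rw [QuadraticMap.map_add f, QuadraticMap.map_smul, QuadraticMap.polar_smul_right]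
    simp only [smul_eq_mul]
    ring
  obtain ⟨t, hpt, hgt⟩ : ∃ t : ℝ, p (x + t • y) = 0 ∧ t * QuadraticMap.polar g x y ≤ 0 := by
    set b := QuadraticMap.polar p x y
    set r := √(b ^ 2 - 4 * p y * p x)
    have hr : r ^ 2 = b ^ 2 - 4 * p y * p x :=
      Real.sq_sqrt (by nlinarith [sq_nonneg b, mul_pos hpy (neg_pos.2 hpx)])
    have hbr : |b| ≤ r := Real.abs_le_sqrt (by nlinarith [mul_pos hpy (neg_pos.2 hpx)])
    have root (s : ℝ) (hs : s ^ 2 = r ^ 2) : p (x + ((-b + s) / (2 * p y)) • y) = 0 := by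
      rw [expand]
      field_simp
      linear_combination hs + hr
    rcases le_total (QuadraticMap.polar g x y) 0 with hg | hg
    · exact ⟨(-b + r) / (2 * p y), root r rfl, mul_nonpos_of_nonneg_of_nonpos
        (div_nonneg (by linarith [le_abs_self b]) (by positivity)) hg⟩
    · exact ⟨(-b + -r) / (2 * p y), root (-r) (by ring), mul_nonpos_of_nonpos_of_nonneg
        (div_nonpos_of_nonpos_of_nonneg (by linarith [neg_abs_le b]) (by positivity)) hg⟩
  refine ⟨x + t • y, fun h0 => ?_, hpt, ?_⟩
  · have hx : p x = t ^ 2 * p y := by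
      rw [eq_neg_of_add_eq_zero_left h0, QuadraticMap.map_neg, QuadraticMap.map_smul, smul_eq_mul,
        sq]
    nlinarith [mul_nonneg (sq_nonneg t) hpy.le]
  · rw [expand]
    nlinarith [mul_nonneg (sq_nonneg t) (neg_nonneg.2 hgy)]

variable {E : Type*} [NormedAddCommGroup E] [NormedSpace ℝ E]

theorem posDef_iff_forall_mem_sphere {g : QuadraticForm ℝ E} :
    g.PosDef ↔ ∀ x ∈ sphere (0 : E) 1, 0 < g x := by
  refine ⟨fun h x hx => h x (ne_of_mem_sphere hx one_ne_zero), fun h x hx => ?_⟩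
  have hpos : 0 < g (‖x‖⁻¹ • x) := h _ (by simp [norm_smul, hx])
  rw [QuadraticMap.map_smul, smul_eq_mul] at hpos
  exact pos_of_mul_pos_right hpos (mul_self_nonneg _)

variable [FiniteDimensional ℝ E]

theorem continuous_quadraticForm (g : QuadraticForm ℝ E) : Continuous g := by
  have h (x : E) : g x = (QuadraticMap.associated g).toContinuousBilinearMap x x :=
    (QuadraticMap.associated_eq_self_apply ℝ g x).symm
  rw [funext h]
  fun_prop

theorem exists_pos_forall_posDef_add_smul {g : QuadraticForm ℝ E} (hg : g.PosDef)
    (k : QuadraticForm ℝ E) : ∃ δ > (0 : ℝ), ∀ ε : ℝ, |ε| < δ → (g + ε • k).PosDef := by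
  rcases (sphere (0 : E) 1).eq_empty_or_nonempty with hempty | hnonempty
  · exact ⟨1, one_pos, fun ε _ => posDef_iff_forall_mem_sphere.2 (by simp [hempty])⟩
  obtain ⟨x₀, hx₀, hmin⟩ := (isCompact_sphere (0 : E) 1).exists_isMinOn hnonempty
    (continuous_quadraticForm g).continuousOn
  obtain ⟨b, hb⟩ := (isCompact_sphere (0 : E) 1).exists_bound_of_continuousOn
    (continuous_quadraticForm k).continuousOn
  have hgx₀ : 0 < g x₀ := posDef_iff_forall_mem_sphere.1 hg x₀ hx₀
  have hb0 : 0 ≤ b := (norm_nonneg _).trans (hb x₀ hx₀)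
  refine ⟨g x₀ / (b + 1), by positivity, fun ε hε => ?_⟩
  refine posDef_iff_forall_mem_sphere.2 fun x hx => ?_
  have hk : |ε * k x| < g x₀ := by
    calc |ε * k x| ≤ |ε| * (b + 1) := by
          rw [abs_mul]
          exact mul_le_mul_of_nonneg_left ((hb x hx).trans (by linarith)) (abs_nonneg _)
      _ < g x₀ := (lt_div_iff₀ (by positivity)).1 hε
  have hgx : g x₀ ≤ g x := hmin hx
  simp only [_root_.add_apply, _root_.smul_apply, smul_eq_mul]
  linarith [neg_abs_le (ε * k x)]

theorem exists_pos_posDef_sub_smul {g : QuadraticForm ℝ E} (hg : g.PosDef)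
    (k : QuadraticForm ℝ E) : ∃ ε > (0 : ℝ), (g - ε • k).PosDef := by
  obtain ⟨δ, hδ, h⟩ := exists_pos_forall_posDef_add_smul hg k
  refine ⟨δ / 2, by positivity, ?_⟩
  have hsub : g - (δ / 2) • k = g + (-(δ / 2)) • k := by
    ext x
    simp only [_root_.sub_apply, _root_.add_apply, _root_.smul_apply, smul_eq_mul]
    ring
  rw [hsub]
  exact h _ (by rw [abs_neg, abs_of_pos (by positivity)]; linarith)

theorem isClosed_setOf_exists_mem_sphere {S : Set (E × ℝ)} (hS : IsClosed S) :
    IsClosed {α : ℝ | ∃ x ∈ sphere (0 : E) 1, (x, α) ∈ S} := by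
  have himage : {α : ℝ | ∃ x ∈ sphere (0 : E) 1, (x, α) ∈ S} =
      Prod.snd '' {z : sphere (0 : E) 1 × ℝ | (z.1.1, z.2) ∈ S} := by
    ext α
    simp
  rw [himage]
  exact isClosedMap_snd_of_compactSpace _ (hS.preimage (by fun_prop))

theorem exists_pos_exists_mem_sphere_le {θ a c : QuadraticForm ℝ E} (hθ : θ.PosDef)
    (hbad : ∀ α : ℝ, 0 < α → ¬ (α • θ - (α ^ 2 • a + c)).PosDef) :
    ∃ α : ℝ, 0 < α ∧
      (∃ x ∈ sphere (0 : E) 1, α * θ x ≤ α ^ 2 * a x + c x ∧ α ^ 2 * a x ≤ c x) ∧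
      ∃ y ∈ sphere (0 : E) 1, α * θ y ≤ α ^ 2 * a y + c y ∧ c y ≤ α ^ 2 * a y := by
  have hθc := continuous_quadraticForm θ
  have hac := continuous_quadraticForm a
  have hcc := continuous_quadraticForm c
  have hclosed : IsClosed {z : E × ℝ | z.2 * θ z.1 ≤ z.2 ^ 2 * a z.1 + c z.1} :=
    isClosed_le (by fun_prop) (by fun_prop)
  let low := {α : ℝ | ∃ x ∈ sphere (0 : E) 1, α * θ x ≤ α ^ 2 * a x + c x ∧ α ^ 2 * a x ≤ c x}
  let high := {α : ℝ | ∃ x ∈ sphere (0 : E) 1, α * θ x ≤ α ^ 2 * a x + c x ∧ c x ≤ α ^ 2 * a x}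
  have hlow : IsClosed low := isClosed_setOf_exists_mem_sphere <| hclosed.inter <|
    isClosed_le (f := fun z : E × ℝ => z.2 ^ 2 * a z.1) (g := fun z => c z.1)
      (by fun_prop) (by fun_prop)
  have hhigh : IsClosed high := isClosed_setOf_exists_mem_sphere <| hclosed.inter <|
    isClosed_le (f := fun z : E × ℝ => c z.1) (g := fun z => z.2 ^ 2 * a z.1)
      (by fun_prop) (by fun_prop)
  have hcover : Set.Ioi 0 ⊆ low ∪ high := fun α hα => by
    have hnot := hbad α hα
    simp only [posDef_iff_forall_mem_sphere, not_forall, not_lt, _root_.sub_apply,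
      _root_.add_apply, _root_.smul_apply, smul_eq_mul, sub_nonpos] at hnot
    obtain ⟨x, hx, hle⟩ := hnot
    exact (le_total (α ^ 2 * a x) (c x)).imp (⟨x, hx, hle, ·⟩) (⟨x, hx, hle, ·⟩)
  obtain ⟨ε, hε, hεpos⟩ := exists_pos_posDef_sub_smul hθ ((2 : ℝ) • a)
  obtain ⟨δ, hδ, hδpos⟩ := exists_pos_posDef_sub_smul hθ ((2 : ℝ) • c)
  have hε_notMem : ε ∉ high := by
    rintro ⟨x, hx, h1, h2⟩
    have hx := posDef_iff_forall_mem_sphere.1 hεpos x hx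
    simp only [_root_.sub_apply, _root_.smul_apply, smul_eq_mul] at hx
    nlinarith
  have hδ_notMem : δ⁻¹ ∉ low := by
    rintro ⟨x, hx, h1, h2⟩
    have hx := posDef_iff_forall_mem_sphere.1 hδpos x hx
    simp only [_root_.sub_apply, _root_.smul_apply, smul_eq_mul] at hx
    have : δ⁻¹ * θ x ≤ 2 * c x := by linarith
    rw [inv_mul_le_iff₀ hδ] at this
    linarith
  obtain ⟨α, hα, hαlow, hαhigh⟩ := isPreconnected_closed_iff.1 (isPreconnected_Ioi (a := (0 : ℝ)))
    low high hlow hhigh hcover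
    ⟨ε, hε, (hcover hε).resolve_right hε_notMem⟩
    ⟨δ⁻¹, inv_pos.2 hδ, (hcover (inv_pos.2 hδ)).resolve_left hδ_notMem⟩
  exact ⟨α, hα, hαlow, hαhigh⟩

theorem exists_pos_posDef_smul_sub {θ a c : QuadraticForm ℝ E} (hθ : θ.PosDef)
    (hdisc : ∀ x ≠ 0, 4 * (a x * c x) < θ x ^ 2) :
    ∃ α : ℝ, 0 < α ∧ (α • θ - (α ^ 2 • a + c)).PosDef := by
  by_contra! hbad
  obtain ⟨α, hα, ⟨x, hx, hgx, hpx⟩, y, hy, hgy, hpy⟩ := exists_pos_exists_mem_sphere_le hθ hbad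
  let p := α ^ 2 • a - c
  let g := α • θ - (α ^ 2 • a + c)
  have hp (z : E) : p z = α ^ 2 * a z - c z := rfl
  have hg (z : E) : g z = α * θ z - (α ^ 2 * a z + c z) := rfl
  have hzero (z : E) (hz : z ≠ 0) (hpz : p z = 0) : 0 < g z := by
    by_contra! hgz
    rw [hp] at hpz
    rw [hg] at hgz
    have hle : θ z ≤ 2 * (α * a z) := le_of_mul_le_mul_left (by linarith) hα
    nlinarith [hθ z hz, hdisc z hz]
  have hx0 := ne_of_mem_sphere hx one_ne_zero
  have hy0 := ne_of_mem_sphere hy one_ne_zero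
  rw [← sub_nonpos, ← hg] at hgx hgy
  rw [← sub_nonpos, ← hp] at hpx
  rw [← sub_nonneg, ← hp] at hpy
  have hpx' : p x < 0 := hpx.lt_of_ne fun h => (hzero x hx0 h).not_ge hgx
  have hpy' : 0 < p y := hpy.lt_of_ne' fun h => (hzero y hy0 h).not_ge hgy
  obtain ⟨z, hz, hpz, hgz⟩ := exists_ne_zero_eq_zero_and_nonpos hpx' hpy' hgx hgy
  exact (hzero z hz hpz).not_ge hgz

end QuadraticForms

section MatrixForms

variable {ι κ μ : Type*} [Fintype κ]

theorem isSymm_mul_mul_transpose {A : Matrix κ κ ℝ} (hA : A.IsSymm) (B : Matrix ι κ ℝ) :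
    (B * A * Bᵀ).IsSymm := by
  rw [IsSymm, transpose_mul, transpose_mul, transpose_transpose, hA.eq, Matrix.mul_assoc]

variable [Fintype ι] [Fintype μ]

theorem posDef_real_iff {A : Matrix ι ι ℝ} :
    A.PosDef ↔ A.IsSymm ∧ ∀ x, x ≠ 0 → 0 < x ⬝ᵥ (A *ᵥ x) := by
  rw [posDef_iff_dotProduct_mulVec]
  simp [IsHermitian, IsSymm, conjTranspose_eq_transpose_of_trivial]

theorem posSemidef_real_iff {A : Matrix ι ι ℝ} :
    A.PosSemidef ↔ A.IsSymm ∧ ∀ x, 0 ≤ x ⬝ᵥ (A *ᵥ x) := by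
  rw [posSemidef_iff_dotProduct_mulVec]
  simp [IsHermitian, IsSymm, conjTranspose_eq_transpose_of_trivial]

theorem dotProduct_transpose_mul_mul_mulVec (A : Matrix κ κ ℝ) (B : Matrix κ ι ℝ) (x : ι → ℝ) :
    x ⬝ᵥ ((Bᵀ * A * B) *ᵥ x) = (B *ᵥ x) ⬝ᵥ (A *ᵥ (B *ᵥ x)) := by
  rw [← mulVec_mulVec, ← mulVec_mulVec, dotProduct_mulVec, vecMul_transpose]

theorem dotProduct_mul_mul_transpose_mulVec (A : Matrix κ κ ℝ) (B : Matrix ι κ ℝ) (x : ι → ℝ) :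
    x ⬝ᵥ ((B * A * Bᵀ) *ᵥ x) = (Bᵀ *ᵥ x) ⬝ᵥ (A *ᵥ (Bᵀ *ᵥ x)) :=
  dotProduct_transpose_mul_mul_mulVec A Bᵀ x

theorem toQuadraticForm'_apply [DecidableEq ι] (A : Matrix ι ι ℝ) (x : ι → ℝ) :
    A.toQuadraticForm' x = x ⬝ᵥ (A *ᵥ x) := by
  simp [toQuadraticForm', toLinearMap₂'_apply']

theorem sq_dotProduct_mulVec_le {A : Matrix ι ι ℝ} (hA : A.PosSemidef) (x y : ι → ℝ) :
    (x ⬝ᵥ (A *ᵥ y)) ^ 2 ≤ (x ⬝ᵥ (A *ᵥ x)) * (y ⬝ᵥ (A *ᵥ y)) := by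
  classical
  have hsymm : LinearMap.IsSymm (toBilin' A) :=
    ⟨(isSymm_toBilin'_iff_isSymm.2 (posSemidef_real_iff.1 hA).1).eq⟩
  simpa only [toBilin'_apply'] using (toBilin' A).apply_sq_le_of_symm
    (fun z => by simpa only [toBilin'_apply'] using (posSemidef_real_iff.1 hA).2 z) hsymm x y

theorem mulVec_nonsing_inv_mulVec [DecidableEq ι] {A : Matrix ι ι ℝ} (hA : A.PosDef) (x : ι → ℝ) :
    A *ᵥ (A⁻¹ *ᵥ x) = x := by
  rw [mulVec_mulVec, mul_nonsing_inv _ ((isUnit_iff_isUnit_det _).1 hA.isUnit), one_mulVec]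

theorem sq_dotProduct_le [DecidableEq ι] {A : Matrix ι ι ℝ} (hA : A.PosDef) (x y : ι → ℝ) :
    (x ⬝ᵥ y) ^ 2 ≤ (x ⬝ᵥ (A *ᵥ x)) * (y ⬝ᵥ (A⁻¹ *ᵥ y)) := by
  have h := sq_dotProduct_mulVec_le hA.posSemidef x (A⁻¹ *ᵥ y)
  rwa [mulVec_nonsing_inv_mulVec hA, dotProduct_comm (A⁻¹ *ᵥ y)] at h

theorem sq_dotProduct_mulVec_le_of_posSemidef_sub [DecidableEq κ] {W : Matrix μ μ ℝ}
    {N : Matrix κ κ ℝ} {Δ : Matrix μ κ ℝ} (hN : N.PosDef) (hΔ : (W - Δ * N * Δᵀ).PosSemidef)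
    (x : μ → ℝ) (y : κ → ℝ) :
    (x ⬝ᵥ (Δ *ᵥ y)) ^ 2 ≤ (x ⬝ᵥ (W *ᵥ x)) * (y ⬝ᵥ (N⁻¹ *ᵥ y)) := by
  have hx : (Δᵀ *ᵥ x) ⬝ᵥ (N *ᵥ (Δᵀ *ᵥ x)) ≤ x ⬝ᵥ (W *ᵥ x) := by
    have h := (posSemidef_real_iff.1 hΔ).2 x
    rwa [sub_mulVec, dotProduct_sub, dotProduct_mul_mul_transpose_mulVec, sub_nonneg] at h
  calc (x ⬝ᵥ (Δ *ᵥ y)) ^ 2 = ((Δᵀ *ᵥ x) ⬝ᵥ y) ^ 2 := by rw [dotProduct_mulVec, mulVec_transpose]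
    _ ≤ ((Δᵀ *ᵥ x) ⬝ᵥ (N *ᵥ (Δᵀ *ᵥ x))) * (y ⬝ᵥ (N⁻¹ *ᵥ y)) := sq_dotProduct_le hN _ _
    _ ≤ _ := by
      gcongr
      exact (posSemidef_real_iff.1 hN.inv.posSemidef).2 y

theorem exists_posSemidef_sub_and_dotProduct_mulVec_eq [DecidableEq κ] {W : Matrix μ μ ℝ}
    {N : Matrix κ κ ℝ} (hW : W.PosSemidef) (hN : N.PosDef) (x : μ → ℝ) (y : κ → ℝ) :
    ∃ Δ : Matrix μ κ ℝ, (W - Δ * N * Δᵀ).PosSemidef ∧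
      x ⬝ᵥ (Δ *ᵥ y) = -√((x ⬝ᵥ (W *ᵥ x)) * (y ⬝ᵥ (N⁻¹ *ᵥ y))) := by
  set a := x ⬝ᵥ (W *ᵥ x)
  set c := y ⬝ᵥ (N⁻¹ *ᵥ y) with hc
  have ha0 : 0 ≤ a := (posSemidef_real_iff.1 hW).2 x
  have hc0 : 0 ≤ c := (posSemidef_real_iff.1 hN.inv.posSemidef).2 y
  rcases (mul_nonneg ha0 hc0).eq_or_lt with hac | hac
  · exact ⟨0, by simpa using hW, by simp [← hac]⟩
  have hsq : √(a * c) ^ 2 = a * c := Real.sq_sqrt hac.le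
  refine ⟨-(√(a * c))⁻¹ • vecMulVec (W *ᵥ x) (N⁻¹ *ᵥ y),
    posSemidef_real_iff.2 ⟨?_, fun z => ?_⟩, ?_⟩
  · exact (posSemidef_real_iff.1 hW).1.sub (isSymm_mul_mul_transpose (posDef_real_iff.1 hN).1 _)
  · have hcs := sq_dotProduct_mulVec_le hW z x
    rw [sub_mulVec, dotProduct_sub, dotProduct_mul_mul_transpose_mulVec, transpose_smul,
      transpose_vecMulVec, smul_mulVec, vecMulVec_mulVec, mulVec_smul, mulVec_smul,
      mulVec_nonsing_inv_mulVec hN]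
    simp only [smul_dotProduct, dotProduct_smul, op_smul_eq_smul, smul_eq_mul,
      dotProduct_comm (N⁻¹ *ᵥ y) y, dotProduct_comm (W *ᵥ x) z, ← hc, sub_nonneg]
    calc _ = (z ⬝ᵥ (W *ᵥ x)) ^ 2 * c / √(a * c) ^ 2 := by ring
      _ ≤ z ⬝ᵥ (W *ᵥ z) := by
        rw [hsq, div_le_iff₀ hac, ← mul_assoc]
        exact mul_le_mul_of_nonneg_right hcs hc0
  · rw [smul_mulVec, vecMulVec_mulVec, dotProduct_smul, op_smul_eq_smul, dotProduct_smul,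
      dotProduct_comm (N⁻¹ *ᵥ y) y, smul_eq_mul, smul_eq_mul, mul_comm c, neg_mul, inv_mul_eq_div,
      Real.div_sqrt]

theorem dotProduct_add_transpose_mulVec (A : Matrix ι ι ℝ) (x : ι → ℝ) :
    x ⬝ᵥ ((A + Aᵀ) *ᵥ x) = 2 * (x ⬝ᵥ (A *ᵥ x)) := by
  rw [add_mulVec, dotProduct_add, mulVec_transpose, dotProduct_comm x (x ᵥ* A),
    ← dotProduct_mulVec, two_mul]

theorem dotProduct_mul_mul_mulVec (M : Matrix ι μ ℝ) (Δ : Matrix μ κ ℝ) (E : Matrix κ ι ℝ)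
    (x : ι → ℝ) : x ⬝ᵥ ((M * Δ * E) *ᵥ x) = (Mᵀ *ᵥ x) ⬝ᵥ (Δ *ᵥ (E *ᵥ x)) := by
  rw [← mulVec_mulVec, ← mulVec_mulVec, dotProduct_mulVec, mulVec_transpose]

end MatrixForms

section Petersen

variable {ι κ μ : Type*} [Finite ι] [Fintype κ] [Fintype μ]

theorem exists_posDef_sub_of_forall_posDef_add [DecidableEq κ] {Θ : Matrix ι ι ℝ}
    {M : Matrix ι μ ℝ} {E : Matrix κ ι ℝ} {W : Matrix μ μ ℝ} {N : Matrix κ κ ℝ}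
    (hW : W.PosSemidef) (hN : N.PosDef)
    (h : ∀ Δ : Matrix μ κ ℝ, (W - Δ * N * Δᵀ).PosSemidef →
      (Θ + (M * Δ * E + (M * Δ * E)ᵀ)).PosDef) :
    ∃ α : ℝ, 0 < α ∧ (Θ - (α • (M * W * Mᵀ) + α⁻¹ • (Eᵀ * N⁻¹ * E))).PosDef := by
  classical
  cases nonempty_fintype ι
  have hΘ : Θ.PosDef := by simpa using h 0 (by simpa using hW)
  have hdisc (x : ι → ℝ) (hx : x ≠ 0) : 4 * ((M * W * Mᵀ).toQuadraticForm' x *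
      (Eᵀ * N⁻¹ * E).toQuadraticForm' x) < Θ.toQuadraticForm' x ^ 2 := by
    obtain ⟨Δ, hΔ, hval⟩ :=
      exists_posSemidef_sub_and_dotProduct_mulVec_eq hW hN (Mᵀ *ᵥ x) (E *ᵥ x)
    have hpos := (posDef_real_iff.1 (h Δ hΔ)).2 x hx
    rw [add_mulVec, dotProduct_add, dotProduct_add_transpose_mulVec,
      dotProduct_mul_mul_mulVec, hval, mul_neg, ← sub_eq_add_neg, sub_pos,
      ← lt_div_iff₀' two_pos] at hpos
    simp only [toQuadraticForm'_apply, dotProduct_transpose_mul_mul_mulVec,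
      dotProduct_mul_mul_transpose_mulVec]
    linarith [Real.lt_sq_of_sqrt_lt hpos]
  obtain ⟨α, hα, hpos⟩ := exists_pos_posDef_smul_sub hΘ.toQuadraticForm' hdisc
  refine ⟨α, hα, posDef_real_iff.2 ⟨(posDef_real_iff.1 hΘ).1.sub
    (((isSymm_mul_mul_transpose (posSemidef_real_iff.1 hW).1 M).smul α).add
      ((isSymm_mul_mul_transpose (posDef_real_iff.1 hN.inv).1 Eᵀ).smul α⁻¹)), fun x hx => ?_⟩⟩
  refine pos_of_mul_pos_right (a := α) ?_ hα.le
  convert hpos x hx using 1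
  simp only [_root_.sub_apply, _root_.add_apply, _root_.smul_apply, toQuadraticForm'_apply,
    sub_mulVec, add_mulVec, smul_mulVec, dotProduct_sub, dotProduct_add, dotProduct_smul,
    smul_eq_mul]
  field_simp

theorem posDef_add_of_posDef_sub [DecidableEq κ] {Θ : Matrix ι ι ℝ} {M : Matrix ι μ ℝ}
    {E : Matrix κ ι ℝ} {W : Matrix μ μ ℝ} {N : Matrix κ κ ℝ} {Δ : Matrix μ κ ℝ} {α : ℝ}
    (hW : W.PosSemidef) (hN : N.PosDef) (hα : 0 < α)
    (h : (Θ - (α • (M * W * Mᵀ) + α⁻¹ • (Eᵀ * N⁻¹ * E))).PosDef)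
    (hΔ : (W - Δ * N * Δᵀ).PosSemidef) : (Θ + (M * Δ * E + (M * Δ * E)ᵀ)).PosDef := by
  cases nonempty_fintype ι
  have hΘ : Θ.IsSymm := by
    have hsymm := (posDef_real_iff.1 h).1.add
      (((isSymm_mul_mul_transpose (posSemidef_real_iff.1 hW).1 M).smul α).add
        ((isSymm_mul_mul_transpose (posDef_real_iff.1 hN.inv).1 Eᵀ).smul α⁻¹))
    rwa [transpose_transpose, sub_add_cancel] at hsymm
  refine posDef_real_iff.2 ⟨hΘ.add (isSymm_add_transpose_self _), fun x hx => ?_⟩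
  have hpos := (posDef_real_iff.1 h).2 x hx
  have ha := (posSemidef_real_iff.1 hW).2 (Mᵀ *ᵥ x)
  have hc := (posSemidef_real_iff.1 hN.inv.posSemidef).2 (E *ᵥ x)
  have hac := sq_dotProduct_mulVec_le_of_posSemidef_sub hN hΔ (Mᵀ *ᵥ x) (E *ᵥ x)
  simp only [sub_mulVec, add_mulVec, smul_mulVec, dotProduct_sub, dotProduct_add,
    dotProduct_smul, smul_eq_mul, dotProduct_transpose_mul_mul_mulVec,
    dotProduct_mul_mul_transpose_mulVec] at hpos
  rw [add_mulVec, dotProduct_add, dotProduct_add_transpose_mulVec, dotProduct_mul_mul_mulVec]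
  set a := (Mᵀ *ᵥ x) ⬝ᵥ (W *ᵥ (Mᵀ *ᵥ x))
  set c := (E *ᵥ x) ⬝ᵥ (N⁻¹ *ᵥ (E *ᵥ x))
  have hamgm : (2 * ((Mᵀ *ᵥ x) ⬝ᵥ (Δ *ᵥ (E *ᵥ x)))) ^ 2 ≤ (α * a + α⁻¹ * c) ^ 2 := by
    have hcross : α * a * (α⁻¹ * c) = a * c := by field_simp
    nlinarith [sq_nonneg (α * a - α⁻¹ * c)]
  linarith [(abs_le_of_sq_le_sq' hamgm (by positivity)).1]

theorem exists_pos_forall_posDef_add_smul_of_isSymm {A B : Matrix ι ι ℝ} (hA : A.PosDef)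
    (hB : B.IsSymm) : ∃ δ > (0 : ℝ), ∀ ε : ℝ, |ε| < δ → (A + ε • B).PosDef := by
  classical
  cases nonempty_fintype ι
  obtain ⟨δ, hδ, h⟩ := exists_pos_forall_posDef_add_smul hA.toQuadraticForm' B.toQuadraticForm'
  refine ⟨δ, hδ, fun ε hε => posDef_real_iff.2
    ⟨(posDef_real_iff.1 hA).1.add (hB.smul ε), fun x hx => ?_⟩⟩
  simpa [toQuadraticForm'_apply, add_mulVec, smul_mulVec, dotProduct_add] using h ε hε x hx

end Petersen

section Schur

theorem posDef_submatrix_equiv {ι κ : Type*} {A : Matrix ι ι ℝ} (e : κ ≃ ι) :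
    (A.submatrix e e).PosDef ↔ A.PosDef :=
  ⟨fun h => by simpa using h.submatrix e.symm.injective, fun h => h.submatrix e.injective⟩

variable {ι κ φ : Type*} [Finite ι]

theorem posDef_fromBlocks_iff [Fintype κ] [DecidableEq κ] (A : Matrix ι ι ℝ) (B : Matrix κ ι ℝ)
    {K : Matrix κ κ ℝ} (hK : K.PosDef) :
    (fromBlocks A Bᵀ B K).PosDef ↔ (A - Bᵀ * K⁻¹ * B).PosDef := by
  classical
  cases nonempty_fintype ι
  let := hK.isUnit.invertible
  have hsemi : (fromBlocks A Bᵀ B K).PosSemidef ↔ (A - Bᵀ * K⁻¹ * B).PosSemidef := by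
    simpa only [conjTranspose_eq_transpose_of_trivial, transpose_transpose] using
      PosDef.fromBlocks₂₂ A Bᵀ hK
  have hunit : IsUnit (fromBlocks A Bᵀ B K) ↔ IsUnit (A - Bᵀ * K⁻¹ * B) := by
    rw [isUnit_fromBlocks_iff_of_invertible₂₂, invOf_eq_nonsing_inv]
  constructor <;> intro h
  · exact (hsemi.1 h.posSemidef).posDef_iff_isUnit.2 (hunit.1 h.isUnit)
  · exact (hsemi.2 h.posSemidef).posDef_iff_isUnit.2 (hunit.2 h.isUnit)

theorem posDef_fromBlocks_fromRows_iff [Finite κ] [Fintype φ] [DecidableEq φ]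
    (A : Matrix ι ι ℝ) (B₁ : Matrix κ ι ℝ) (B₂ : Matrix φ ι ℝ) (D : Matrix κ κ ℝ)
    (J : Matrix φ κ ℝ) {K : Matrix φ φ ℝ} (hK : K.PosDef) :
    (fromBlocks A (fromRows B₁ B₂)ᵀ (fromRows B₁ B₂) (fromBlocks D Jᵀ J K)).PosDef ↔
      (fromBlocks A B₁ᵀ B₁ D - (fromCols B₂ J)ᵀ * K⁻¹ * fromCols B₂ J).PosDef := by
  rw [← posDef_fromBlocks_iff _ _ hK,
    ← posDef_submatrix_equiv (Equiv.sumAssoc ι κ φ)]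
  convert Iff.rfl using 2
  ext ((i | i) | i) ((j | j) | j) <;> rfl

end Schur

section Dissipation

variable {ι ζ : Type*} [Fintype ι] [Fintype ζ] [DecidableEq ζ] {q pz : ℕ}

/-- The part of the linear matrix inequality for dissipativity of a system with output equation
`z = C x + D w` that does not involve the successor state. The supply function has the matrix
`-(Q S; Sᵀ R)` with `R = T R̃ Tᵀ`, and the quadratic term in `z` is linearised by a Schur
complement with respect to `R̃⁻¹`. -/
noncomputable def supplyLMI (P : Matrix ι ι ℝ) (C : Matrix (Fin pz) ι ℝ)
    (D : Matrix (Fin pz) (Fin q) ℝ) (Q : Matrix (Fin q) (Fin q) ℝ)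
    (S : Matrix (Fin q) (Fin pz) ℝ) (T : Matrix (Fin pz) ζ ℝ) (Rt : Matrix ζ ζ ℝ) :
    Matrix (ι ⊕ (Fin q ⊕ ζ)) (ι ⊕ (Fin q ⊕ ζ)) ℝ :=
  fromBlocks P (fromRows (-(S * C)) (Tᵀ * C))ᵀ (fromRows (-(S * C)) (Tᵀ * C))
    (fromBlocks (-Q - ((S * D)ᵀ + S * D)) (Tᵀ * D)ᵀ (Tᵀ * D) Rt⁻¹)

/-- The linear matrix inequality for dissipativity of `(A, B, C, D)` with storage matrix `P`: a
double Schur complement of the quadratic inequality `DissipationIneq`. -/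
noncomputable def dissLMI (P A : Matrix ι ι ℝ) (B : Matrix ι (Fin q) ℝ)
    (C : Matrix (Fin pz) ι ℝ) (D : Matrix (Fin pz) (Fin q) ℝ) (Q : Matrix (Fin q) (Fin q) ℝ)
    (S : Matrix (Fin q) (Fin pz) ℝ) (T : Matrix (Fin pz) ζ ℝ) (Rt : Matrix ζ ζ ℝ) :
    Matrix ((ι ⊕ (Fin q ⊕ ζ)) ⊕ ι) ((ι ⊕ (Fin q ⊕ ζ)) ⊕ ι) ℝ :=
  fromBlocks (supplyLMI P C D Q S T Rt) (fromCols (P * A) (fromCols (P * B) 0))ᵀ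
    (fromCols (P * A) (fromCols (P * B) 0)) P

variable {P A : Matrix ι ι ℝ} {B : Matrix ι (Fin q) ℝ} {C : Matrix (Fin pz) ι ℝ}
  {D : Matrix (Fin pz) (Fin q) ℝ} {Q : Matrix (Fin q) (Fin q) ℝ}
  {S : Matrix (Fin q) (Fin pz) ℝ} {T : Matrix (Fin pz) ζ ℝ} {Rt : Matrix ζ ζ ℝ}

theorem supplyLMI_sub (hP : P.IsSymm) :
    supplyLMI P C D Q S T Rt - (fromCols A (fromCols B 0))ᵀ * P * fromCols A (fromCols B 0) =
      fromBlocks (P - Aᵀ * P * A) (fromRows (-(S * C) - Bᵀ * P * A) (Tᵀ * C))ᵀ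
        (fromRows (-(S * C) - Bᵀ * P * A) (Tᵀ * C))
        (fromBlocks (-Q - ((S * D)ᵀ + S * D) - Bᵀ * P * B) (Tᵀ * D)ᵀ (Tᵀ * D) Rt⁻¹) := by
  have hAB (i j) : (Aᵀ * (P * B)) i j = (Bᵀ * (P * A)) j i := by
    rw [← transpose_apply (Bᵀ * (P * A)), transpose_mul, transpose_mul, transpose_transpose, hP.eq,
      Matrix.mul_assoc]
  rw [supplyLMI]
  ext (i | i | i) (j | j | j) <;>
    simp [transpose_fromCols, fromRows_mul, mul_fromCols, Matrix.mul_assoc, hAB]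

theorem transpose_mul_nonsing_inv_mul [DecidableEq ι] {κ : Type*} (hP : P.PosDef)
    (F : Matrix ι κ ℝ) :
    (P * F)ᵀ * P⁻¹ * (P * F) = Fᵀ * P * F := by
  rw [transpose_mul, (posDef_real_iff.1 hP).1.eq, ← Matrix.mul_assoc,
    nonsing_inv_mul_cancel_right _ _ ((isUnit_iff_isUnit_det _).1 hP.isUnit)]

theorem dissLMI_schur_storage (hP : P.PosDef) :
    (dissLMI P A B C D Q S T Rt).PosDef ↔
      (supplyLMI P C D Q S T Rt - (fromCols A (fromCols B 0))ᵀ * P *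
        fromCols A (fromCols B 0)).PosDef := by
  classical
  have hF : fromCols (P * A) (fromCols (P * B) 0) =
      P * fromCols A (fromCols B (0 : Matrix ι ζ ℝ)) := by
    rw [mul_fromCols, mul_fromCols, Matrix.mul_zero]
  rw [dissLMI, posDef_fromBlocks_iff _ _ hP, hF, transpose_mul_nonsing_inv_mul hP]

variable [DecidableEq ι]

theorem transpose_mul_mul_dissOuter (R : Matrix (Fin pz) (Fin pz) ℝ) :
    -((dissOuter A B C D)ᵀ *
      fromBlocks (fromBlocks (-P) 0 0 P) 0 0 (fromBlocks Q S Sᵀ R) * dissOuter A B C D) =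
      fromBlocks P (-(S * C))ᵀ (-(S * C)) (-Q - ((S * D)ᵀ + S * D)) -
        (fromCols A B)ᵀ * P * fromCols A B - (fromCols C D)ᵀ * R * fromCols C D := by
  rw [dissOuter, transpose_fromRows, fromCols_mul_fromBlocks, fromCols_mul_fromRows,
    transpose_fromCols, transpose_fromCols, fromRows_mul, fromRows_mul_fromCols, fromRows_mul,
    fromRows_mul_fromCols, Matrix.mul_zero, Matrix.mul_zero, add_zero, zero_add,
    fromBlocks_transpose, fromBlocks_transpose]
  simp only [fromBlocks_multiply, fromBlocks_add, fromBlocks_neg, sub_eq_add_neg]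
  congr 1 <;> simp [Matrix.add_mul, Matrix.mul_assoc] <;> abel

theorem dissipationIneq_iff_posDef_dissLMI (hP : P.PosDef) (hRt : Rt.PosDef) :
    DissipationIneq A B C D Q S (T * Rt * Tᵀ) P ↔ (dissLMI P A B C D Q S T Rt).PosDef := by
  rw [DissipationIneq, transpose_mul_mul_dissOuter, dissLMI_schur_storage hP,
    supplyLMI_sub (posDef_real_iff.1 hP).1,
    posDef_fromBlocks_fromRows_iff _ _ _ _ _ hRt.inv,
    nonsing_inv_nonsing_inv _ ((isUnit_iff_isUnit_det _).1 hRt.isUnit)]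
  convert Iff.rfl using 2
  ext (i | i) (j | j) <;>
    simp [transpose_fromCols, fromRows_mul, mul_fromCols, Matrix.mul_assoc,
      (posDef_real_iff.1 hP).1.eq]

end Dissipation

section Robust

variable {ι κ μ φ ζ : Type*} [Fintype ι] [Fintype μ] [Fintype φ]
  [DecidableEq φ] [Fintype ζ] [DecidableEq ζ] {q pz : ℕ}

/-- The off-diagonal block of `robustLMI`: the successor state weighted by `P`, followed by the
input `Ex x + Ew w` of the uncertainty. -/
def robustLMI₂₁ (P A : Matrix ι ι ℝ) (B : Matrix ι (Fin q) ℝ) (Ex : Matrix κ ι ℝ)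
    (Ew : Matrix κ (Fin q) ℝ) : Matrix (ι ⊕ (κ ⊕ φ)) (ι ⊕ (Fin q ⊕ ζ)) ℝ :=
  fromRows (fromCols (P * A) (fromCols (P * B) 0)) (fromRows (fromCols Ex (fromCols Ew 0)) 0)

/-- The lower right block of `robustLMI`, which carries the multiplier `α` of the uncertainty
bound. -/
noncomputable def robustLMI₂₂ (P : Matrix ι ι ℝ) (M : Matrix ι μ ℝ) (N : Matrix κ κ ℝ)
    (Ξ : Matrix μ φ ℝ) (Λ : Matrix φ φ ℝ) (α : ℝ) :
    Matrix (ι ⊕ (κ ⊕ φ)) (ι ⊕ (κ ⊕ φ)) ℝ :=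
  fromBlocks P (fromRows 0 (α • (P * M * Ξ)ᵀ))ᵀ (fromRows 0 (α • (P * M * Ξ)ᵀ))
    (fromBlocks (α • N) 0 0 (α • Λ⁻¹))

/-- Multiplier form of the dissipation inequality for all systems `(A + M Δ Ex, B + M Δ Ew, C, D)`
with `Δ N Δᵀ ⪯ Ξ Λ Ξᵀ`; the scalar `α` is the multiplier of the uncertainty bound. -/
noncomputable def robustLMI (P A : Matrix ι ι ℝ) (B : Matrix ι (Fin q) ℝ)
    (C : Matrix (Fin pz) ι ℝ) (D : Matrix (Fin pz) (Fin q) ℝ) (Q : Matrix (Fin q) (Fin q) ℝ)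
    (S : Matrix (Fin q) (Fin pz) ℝ) (T : Matrix (Fin pz) ζ ℝ) (Rt : Matrix ζ ζ ℝ)
    (M : Matrix ι μ ℝ) (Ex : Matrix κ ι ℝ) (Ew : Matrix κ (Fin q) ℝ) (N : Matrix κ κ ℝ)
    (Ξ : Matrix μ φ ℝ) (Λ : Matrix φ φ ℝ) (α : ℝ) :
    Matrix ((ι ⊕ (Fin q ⊕ ζ)) ⊕ (ι ⊕ (κ ⊕ φ))) ((ι ⊕ (Fin q ⊕ ζ)) ⊕ (ι ⊕ (κ ⊕ φ))) ℝ :=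
  fromBlocks (supplyLMI P C D Q S T Rt) (robustLMI₂₁ P A B Ex Ew)ᵀ (robustLMI₂₁ P A B Ex Ew)
    (robustLMI₂₂ P M N Ξ Λ α)

variable {P A : Matrix ι ι ℝ} {B : Matrix ι (Fin q) ℝ} {C : Matrix (Fin pz) ι ℝ}
  {D : Matrix (Fin pz) (Fin q) ℝ} {Q : Matrix (Fin q) (Fin q) ℝ}
  {S : Matrix (Fin q) (Fin pz) ℝ} {T : Matrix (Fin pz) ζ ℝ} {Rt : Matrix ζ ζ ℝ}
  {M : Matrix ι μ ℝ} {Ex : Matrix κ ι ℝ} {Ew : Matrix κ (Fin q) ℝ} {N : Matrix κ κ ℝ}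
  {Ξ : Matrix μ φ ℝ} {Λ : Matrix φ φ ℝ} {α : ℝ}

theorem robustLMI_add_smul (P' : Matrix ι ι ℝ) (ε : ℝ) :
    robustLMI (P + ε • P') A B C D Q S T Rt M Ex Ew N Ξ Λ α =
      robustLMI P A B C D Q S T Rt M Ex Ew N Ξ Λ α +
        ε • (robustLMI P' A B C D Q S T Rt M Ex Ew N Ξ Λ α -
          robustLMI 0 A B C D Q S T Rt M Ex Ew N Ξ Λ α) := by
  ext ((i | i | i) | i | i | i) ((j | j | j) | j | j | j) <;>
    simp [robustLMI, robustLMI₂₁, robustLMI₂₂, supplyLMI, Matrix.add_mul] <;> ring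

theorem isSymm_robustLMI_sub_robustLMI_zero (hP : P.IsSymm) :
    (robustLMI P A B C D Q S T Rt M Ex Ew N Ξ Λ α -
      robustLMI 0 A B C D Q S T Rt M Ex Ew N Ξ Λ α).IsSymm := by
  refine IsSymm.ext fun i j => ?_
  rcases i with (i | i | i) | i | i | i <;> rcases j with (j | j | j) | j | j | j <;>
    simp [robustLMI, robustLMI₂₁, robustLMI₂₂, supplyLMI, hP.apply]

theorem exists_pos_robustLMI (hN : N.PosDef) (hΛ : Λ.PosDef)
    (h : (robustLMI P A B C D Q S T Rt M Ex Ew N Ξ Λ α).PosDef) :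
    ∃ β : ℝ, 0 < β ∧ (robustLMI P A B C D Q S T Rt M Ex Ew N Ξ Λ β).PosDef := by
  rcases isEmpty_or_nonempty (κ ⊕ φ) with hempty | ⟨⟨j⟩⟩
  · refine ⟨1, one_pos, ?_⟩
    convert h using 1
    ext ((i | i) | i | i) ((j | j) | j | j) <;> first
      | rfl
      | exact hempty.elim i
      | exact hempty.elim j
  · refine ⟨α, ?_, h⟩
    have hdiag := h.diag_pos (i := .inr (.inr j))
    rcases j with j | j
    · exact pos_of_mul_pos_left hdiag hN.diag_pos.le
    · exact pos_of_mul_pos_left hdiag hΛ.inv.diag_pos.le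

theorem exists_isUnit_add_smul_one [DecidableEq ι] (A : Matrix ι ι ℝ) {δ : ℝ} (hδ : 0 < δ) :
    ∃ ε : ℝ, |ε| < δ ∧ IsUnit (A + ε • (1 : Matrix ι ι ℝ)) := by
  obtain ⟨ε, hε, hs⟩ := (Set.Ioo_infinite hδ).exists_notMem_finite (finite_real_spectrum (A := -A))
  refine ⟨ε, by rw [abs_of_pos hε.1]; exact hε.2, ?_⟩
  rw [spectrum.notMem_iff] at hs
  convert hs using 1
  rw [Algebra.algebraMap_eq_smul_one, sub_neg_eq_add, add_comm]

theorem exists_pos_forall_posDef_robustLMI_add_smul [Finite κ] {P' : Matrix ι ι ℝ} (hP' : P'.IsSymm)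
    (h : (robustLMI P A B C D Q S T Rt M Ex Ew N Ξ Λ α).PosDef) :
    ∃ δ > (0 : ℝ), ∀ ε : ℝ, |ε| < δ →
      (robustLMI (P + ε • P') A B C D Q S T Rt M Ex Ew N Ξ Λ α).PosDef := by
  simp only [robustLMI_add_smul]
  exact exists_pos_forall_posDef_add_smul_of_isSymm h (isSymm_robustLMI_sub_robustLMI_zero hP')

theorem exists_posDef_robustLMI_isUnit_toBlocks₁₂ [Finite κ] [DecidableEq ι]
    {P A : Matrix (ι ⊕ ι) (ι ⊕ ι) ℝ} {B : Matrix (ι ⊕ ι) (Fin q) ℝ}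
    {C : Matrix (Fin pz) (ι ⊕ ι) ℝ} {M : Matrix (ι ⊕ ι) μ ℝ} {Ex : Matrix κ (ι ⊕ ι) ℝ}
    (hP : P.PosDef)
    (h : (robustLMI P A B C D Q S T Rt M Ex Ew N Ξ Λ α).PosDef) :
    ∃ P' : Matrix (ι ⊕ ι) (ι ⊕ ι) ℝ, P'.PosDef ∧ IsUnit P'.toBlocks₁₂ ∧
      (robustLMI P' A B C D Q S T Rt M Ex Ew N Ξ Λ α).PosDef := by
  have hJ : (fromBlocks (0 : Matrix ι ι ℝ) 1 1 (0 : Matrix ι ι ℝ)).IsSymm := by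
    simp [IsSymm, fromBlocks_transpose]
  obtain ⟨δ₁, hδ₁, hP'⟩ := exists_pos_forall_posDef_add_smul_of_isSymm hP hJ
  obtain ⟨δ₂, hδ₂, hK⟩ := exists_pos_forall_posDef_robustLMI_add_smul hJ h
  obtain ⟨ε, hε, hunit⟩ := exists_isUnit_add_smul_one P.toBlocks₁₂ (lt_min hδ₁ hδ₂)
  exact ⟨_, hP' ε (hε.trans_le (min_le_left _ _)), hunit, hK ε (hε.trans_le (min_le_right _ _))⟩

variable [Fintype κ]

theorem dissLMI_add (Δ : Matrix μ κ ℝ) :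
    dissLMI P (A + M * Δ * Ex) (B + M * Δ * Ew) C D Q S T Rt = dissLMI P A B C D Q S T Rt +
      (fromRows (0 : Matrix (ι ⊕ (Fin q ⊕ ζ)) μ ℝ) (P * M) * Δ *
          fromCols (fromCols Ex (fromCols Ew 0)) (0 : Matrix κ ι ℝ) +
        (fromRows (0 : Matrix (ι ⊕ (Fin q ⊕ ζ)) μ ℝ) (P * M) * Δ *
          fromCols (fromCols Ex (fromCols Ew 0)) (0 : Matrix κ ι ℝ))ᵀ) := by
  simp only [fromRows_mul, mul_fromCols, Matrix.zero_mul, Matrix.mul_zero, dissLMI]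
  ext ((i | i | i) | i) ((j | j | j) | j) <;> simp [Matrix.mul_add, Matrix.mul_assoc]

theorem inv_fromBlocks_smul [DecidableEq κ] (hα : 0 < α) (hN : N.PosDef) (hΛ : Λ.PosDef) :
    (fromBlocks (α • N) 0 0 (α • Λ⁻¹))⁻¹ = fromBlocks (α⁻¹ • N⁻¹) 0 0 (α⁻¹ • Λ) := by
  refine inv_eq_right_inv ?_
  rw [fromBlocks_multiply]
  simp [smul_smul, hα.ne', nonsing_inv_mul _ ((isUnit_iff_isUnit_det _).1 hΛ.isUnit),
    mul_nonsing_inv _ ((isUnit_iff_isUnit_det _).1 hN.isUnit)]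

theorem robustLMI_posDef_iff [DecidableEq κ] (hα : 0 < α) (hN : N.PosDef) (hΛ : Λ.PosDef) :
    (robustLMI P A B C D Q S T Rt M Ex Ew N Ξ Λ α).PosDef ↔
      (dissLMI P A B C D Q S T Rt -
        (α • (fromRows (0 : Matrix (ι ⊕ (Fin q ⊕ ζ)) μ ℝ) (P * M) * (Ξ * Λ * Ξᵀ) *
            (fromRows (0 : Matrix (ι ⊕ (Fin q ⊕ ζ)) μ ℝ) (P * M))ᵀ) +
          α⁻¹ • ((fromCols (fromCols Ex (fromCols Ew 0)) (0 : Matrix κ ι ℝ))ᵀ * N⁻¹ *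
            fromCols (fromCols Ex (fromCols Ew 0)) (0 : Matrix κ ι ℝ)))).PosDef := by
  have hK : (fromBlocks (α • N) 0ᵀ 0 (α • Λ⁻¹)).PosDef := by
    rw [posDef_fromBlocks_iff _ _ (hΛ.inv.smul hα)]
    simpa using hN.smul hα
  rw [transpose_zero] at hK
  rw [robustLMI, robustLMI₂₁, robustLMI₂₂, posDef_fromBlocks_fromRows_iff _ _ _ _ _ hK,
    inv_fromBlocks_smul hα hN hΛ, dissLMI]
  convert Iff.rfl using 3
  generalize fromCols Ex (fromCols Ew (0 : Matrix κ ζ ℝ)) = E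
  simp only [fromCols_fromRows_eq_fromBlocks, fromBlocks_transpose, fromBlocks_multiply,
    transpose_fromCols, transpose_fromRows, fromRows_mul, mul_fromCols]
  ext (i | i) (j | j) <;> simp [smul_smul, hα.ne', Matrix.mul_assoc]

theorem forall_dissipationIneq_iff_exists_robustLMI [DecidableEq ι] (hP : P.PosDef)
    (hRt : Rt.PosDef) (hN : N.PosDef) (hΛ : Λ.PosDef) :
    (∀ Δ : Matrix μ κ ℝ, (Ξ * Λ * Ξᵀ - Δ * N * Δᵀ).PosSemidef →
      DissipationIneq (A + M * Δ * Ex) (B + M * Δ * Ew) C D Q S (T * Rt * Tᵀ) P) ↔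
      ∃ α, (robustLMI P A B C D Q S T Rt M Ex Ew N Ξ Λ α).PosDef := by
  classical
  have hW : (Ξ * Λ * Ξᵀ).PosSemidef := by
    simpa using hΛ.posSemidef.mul_mul_conjTranspose_same Ξ
  simp only [dissipationIneq_iff_posDef_dissLMI hP hRt, dissLMI_add]
  constructor
  · intro h
    obtain ⟨α, hα, hpos⟩ := exists_posDef_sub_of_forall_posDef_add hW hN h
    exact ⟨α, (robustLMI_posDef_iff hα hN hΛ).2 hpos⟩
  · rintro ⟨β, hβ⟩ Δ hΔ
    obtain ⟨α, hα, hpos⟩ := exists_pos_robustLMI hN hΛ hβ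
    exact posDef_add_of_posDef_sub hW hN hα ((robustLMI_posDef_iff hα hN hΛ).1 hpos) hΔ

end Robust

section StoragePartition

variable {ι : Type*} [Fintype ι] [DecidableEq ι] {X Y U VT : Matrix ι ι ℝ}
  {P : Matrix (ι ⊕ ι) (ι ⊕ ι) ℝ}

/-- `P` is symmetric with first block column `col(X, Uᵀ)`, and `col(Y, Vᵀ)` is the first block
column of its inverse. -/
structure IsStoragePartition (P : Matrix (ι ⊕ ι) (ι ⊕ ι) ℝ) (X Y U VT : Matrix ι ι ℝ) : Prop where
  isSymm : P.IsSymm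
  mul_eq : P * fromBlocks Y 1 VT 0 = fromBlocks 1 X 0 Uᵀ

namespace IsStoragePartition

variable (h : IsStoragePartition P X Y U VT)
include h

theorem transpose_fromBlocks_mul :
    (fromBlocks Y 1 VT 0)ᵀ * P = fromBlocks 1 0 Xᵀ U := by
  rw [← h.isSymm.eq, ← transpose_mul, h.mul_eq, fromBlocks_transpose]
  simp

theorem blocks : X.IsSymm ∧ Y.IsSymm ∧ X * Y + U * VT = 1 := by
  have hl : (fromBlocks Y 1 VT 0)ᵀ * (P * fromBlocks Y 1 VT 0) =
      fromBlocks Yᵀ (Yᵀ * X + VTᵀ * Uᵀ) 1 X := by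
    rw [h.mul_eq, fromBlocks_transpose, fromBlocks_multiply]
    simp
  have hr : (fromBlocks Y 1 VT 0)ᵀ * (P * fromBlocks Y 1 VT 0) =
      fromBlocks Y 1 (Xᵀ * Y + U * VT) Xᵀ := by
    rw [← Matrix.mul_assoc, h.transpose_fromBlocks_mul, fromBlocks_multiply]
    simp
  obtain ⟨hY, -, hXY, hX⟩ := fromBlocks_inj.1 (hr.symm.trans hl)
  exact ⟨hX, hY.symm, by rwa [hX] at hXY⟩

theorem transpose_mul_mul_swap :
    (fromBlocks Y 1 VT 0)ᵀ * P * fromBlocks Y 1 VT 0 = fromBlocks Y 1 1 X := by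
  obtain ⟨hX, -, hXY⟩ := h.blocks
  rw [h.transpose_fromBlocks_mul, fromBlocks_multiply, hX.eq, hXY]
  simp

theorem mul_eq' : P * fromBlocks 1 Y 0 VT = fromBlocks X 1 Uᵀ 0 := by
  have hswap : fromBlocks 1 Y 0 VT = fromBlocks Y 1 VT 0 * fromBlocks 0 1 1 0 := by
    simp [fromBlocks_multiply]
  rw [hswap, ← Matrix.mul_assoc, h.mul_eq, fromBlocks_multiply]
  simp

theorem transpose_mul_mul :
    (fromBlocks 1 Y 0 VT)ᵀ * P * fromBlocks 1 Y 0 VT = fromBlocks X 1 1 Y := by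
  obtain ⟨hX, hY, hXY⟩ := h.blocks
  have hYX : Y * X + VTᵀ * Uᵀ = 1 := by
    simpa [transpose_add, transpose_mul, hX.eq, hY.eq] using congrArg transpose hXY
  rw [Matrix.mul_assoc, h.mul_eq', fromBlocks_transpose, fromBlocks_multiply]
  simp [hY.eq, hYX]

end IsStoragePartition

theorem isUnit_fromBlocks_one_zero (Y : Matrix ι ι ℝ) (hVT : IsUnit VT) :
    IsUnit (fromBlocks Y (1 : Matrix ι ι ℝ) VT (0 : Matrix ι ι ℝ)) := by
  have hswap : fromBlocks Y 1 VT 0 = (fromBlocks (1 : Matrix ι ι ℝ) Y 0 VT).submatrix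
      (Equiv.refl _) (Equiv.sumComm ι ι) := by
    ext (i | i) (j | j) <;> rfl
  rw [hswap, isUnit_submatrix_equiv]
  exact isUnit_fromBlocks_zero₂₁.2 ⟨isUnit_one, hVT⟩

theorem IsStoragePartition.isUnit (h : IsStoragePartition P X Y U VT) (hU : IsUnit U) :
    IsUnit VT := by
  have hprod : IsUnit (P * fromBlocks (1 : Matrix ι ι ℝ) Y 0 VT) := by
    rw [h.mul_eq']
    exact isUnit_fromBlocks_one_zero X ((isUnit_transpose U).2 hU)
  rw [isUnit_iff_isUnit_det, det_mul] at hprod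
  exact (isUnit_fromBlocks_zero₂₁.1
    ((isUnit_iff_isUnit_det _).2 (isUnit_of_mul_isUnit_right hprod))).2

theorem exists_isStoragePartition (hX : X.IsSymm) (hpos : (fromBlocks Y 1 1 X).PosDef)
    (hVT : IsUnit VT) (hUV : X * Y + U * VT = 1) :
    ∃ P, P.PosDef ∧ IsStoragePartition P X Y U VT := by
  have hW := isUnit_fromBlocks_one_zero Y hVT
  have hWd := (isUnit_iff_isUnit_det _).1 hW
  set W := fromBlocks Y (1 : Matrix ι ι ℝ) VT (0 : Matrix ι ι ℝ) with hWdef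
  have hP : (W⁻¹ᵀ * fromBlocks Y 1 1 X * W⁻¹).PosDef := by
    have hW' : IsUnit W⁻¹ := isUnit_nonsing_inv_iff.2 hW
    simpa [star_eq_conjTranspose] using (hW'.posDef_star_left_conjugate_iff).2 hpos
  have hY : Y.IsSymm := congrArg toBlocks₁₁ (posDef_real_iff.1 hpos).1
  have hYX : Y * X + VTᵀ * Uᵀ = 1 := by
    simpa [transpose_add, transpose_mul, hX.eq, hY.eq] using congrArg transpose hUV
  have hZ : fromBlocks Y 1 1 X = Wᵀ * fromBlocks 1 X 0 Uᵀ := by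
    rw [hWdef, fromBlocks_transpose, fromBlocks_multiply]
    simp [hY.eq, hYX]
  refine ⟨_, hP, (posDef_real_iff.1 hP).1, ?_⟩
  rw [nonsing_inv_mul_cancel_right _ _ hWd, hZ, transpose_nonsing_inv,
    nonsing_inv_mul_cancel_left _ _ (by rwa [det_transpose])]

theorem isStoragePartition_of_posDef (hP : P.PosDef) :
    IsStoragePartition P P.toBlocks₁₁ P⁻¹.toBlocks₁₁ P.toBlocks₁₂ P⁻¹.toBlocks₂₁ := by
  have hPsymm := (posDef_real_iff.1 hP).1
  refine ⟨hPsymm, ?_⟩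
  have hmul : P * P⁻¹ = 1 := mul_nonsing_inv _ ((isUnit_iff_isUnit_det _).1 hP.isUnit)
  have h21 : P.toBlocks₂₁ = P.toBlocks₁₂ᵀ := congrArg toBlocks₂₁ hPsymm.eq.symm
  generalize P⁻¹ = K at hmul ⊢
  have hblocks : fromBlocks P.toBlocks₁₁ P.toBlocks₁₂ P.toBlocks₂₁ P.toBlocks₂₂ *
      fromBlocks K.toBlocks₁₁ K.toBlocks₁₂ K.toBlocks₂₁ K.toBlocks₂₂ = fromBlocks 1 0 0 1 := by
    rwa [fromBlocks_toBlocks, fromBlocks_toBlocks, fromBlocks_one]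
  rw [fromBlocks_multiply, fromBlocks_inj] at hblocks
  obtain ⟨h₁, -, h₂, -⟩ := hblocks
  conv_lhs => rw [← fromBlocks_toBlocks P, fromBlocks_multiply, h₁, h₂]
  simp [h21]

theorem isUnit_one_sub_mul (h : (fromBlocks X 1 1 Y).PosDef) : IsUnit (1 - X * Y) := by
  have hY : Y.PosDef := h.submatrix (e := Sum.inr) Sum.inr_injective
  have hschur : (X - Y⁻¹).PosDef := by
    simpa using (posDef_fromBlocks_iff X 1 hY).1 (by simpa using h)
  have hfactor : 1 - X * Y = -((X - Y⁻¹) * Y) := by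
    rw [Matrix.sub_mul, nonsing_inv_mul _ ((isUnit_iff_isUnit_det _).1 hY.isUnit), neg_sub]
  rw [hfactor]
  exact (hschur.isUnit.mul hY.isUnit).neg

end StoragePartition

section FullRank

variable {ι κ μ : Type*} [Fintype ι] [Fintype κ]

theorem linearIndependent_row_of_rank_eq_card {A : Matrix ι κ ℝ} (h : A.rank = Fintype.card ι) :
    LinearIndependent ℝ A.row := by
  rw [rank_eq_finrank_span_row] at h
  exact linearIndependent_iff_card_eq_finrank_span.2 h.symm

theorem isUnit_mul_transpose [DecidableEq ι] {A : Matrix ι κ ℝ}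
    (h : LinearIndependent ℝ A.row) : IsUnit (A * Aᵀ) := by
  simpa using (PosDef.mul_conjTranspose_self A (vecMul_injective_iff.2 h)).isUnit

theorem exists_mul_eq_one_of_rank_eq_card [DecidableEq κ] {B : Matrix ι κ ℝ}
    (h : B.rank = Fintype.card κ) : ∃ K : Matrix κ ι ℝ, K * B = 1 := by
  have hunit : IsUnit (Bᵀ * Bᵀᵀ) :=
    isUnit_mul_transpose (linearIndependent_row_of_rank_eq_card (by rwa [rank_transpose]))
  rw [transpose_transpose] at hunit
  exact ⟨(Bᵀ * B)⁻¹ * Bᵀ, by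
    rw [Matrix.mul_assoc, nonsing_inv_mul _ ((isUnit_iff_isUnit_det _).1 hunit)]⟩

theorem posSemidef_mul_mul_transpose_iff [DecidableEq κ] {A : Matrix κ κ ℝ} {B : Matrix ι κ ℝ}
    {K : Matrix κ ι ℝ} (hK : K * B = 1) : (B * A * Bᵀ).PosSemidef ↔ A.PosSemidef := by
  refine ⟨fun h => ?_, fun h => by simpa using h.mul_mul_conjTranspose_same B⟩
  have hA : K * (B * A * Bᵀ) * Kᵀ = A := by
    calc K * (B * A * Bᵀ) * Kᵀ = (K * B) * A * (K * B)ᵀ := by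
          simp only [transpose_mul, Matrix.mul_assoc]
      _ = A := by rw [hK, transpose_one, Matrix.one_mul, Matrix.mul_one]
  simpa [hA] using h.mul_mul_conjTranspose_same K

theorem eq_mul_mul_of_vecMul_eq_zero [DecidableEq κ] {B : Matrix ι κ ℝ}
    {K : Matrix κ ι ℝ} (hK : K * B = 1) {E : Matrix ι μ ℝ}
    (h : ∀ v : ι → ℝ, v ᵥ* B = 0 → v ᵥ* E = 0) : E = B * (K * E) := by
  classical
  have hB : (1 - B * K) * B = 0 := by
    rw [Matrix.sub_mul, Matrix.mul_assoc, hK, Matrix.one_mul, Matrix.mul_one, sub_self]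
  have hE : (1 - B * K) * E = 0 := by
    ext i j
    have hi : (1 - B * K).row i ᵥ* B = 0 := congrFun hB i
    exact congrFun (h _ hi) j
  rwa [Matrix.sub_mul, Matrix.one_mul, Matrix.mul_assoc, sub_eq_zero] at hE

end FullRank

section ConsistentSet

/-- The block row `(I Z)`, which selects a point of the quadratic matrix inequality given by
`matH`. -/
abbrev oneCols {p : ℕ} {κ : Type*} (Z : Matrix (Fin p) κ ℝ) : Matrix (Fin p) (Fin p ⊕ κ) ℝ :=
  fromCols 1 Z

theorem vecMul_eq_zero_of_posSemidef {ι κ φ : Type*} [Fintype ι] [Fintype κ] [Fintype φ]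
    {Φ : Matrix (κ ⊕ φ) (κ ⊕ φ) ℝ} (hΦ : (-Φ.toBlocks₂₂).PosDef) {B : Matrix ι κ ℝ}
    {E : Matrix ι φ ℝ} (h : (fromCols B E * Φ * (fromCols B E)ᵀ).PosSemidef) {v : ι → ℝ}
    (hv : v ᵥ* B = 0) : v ᵥ* E = 0 := by
  have hval : v ⬝ᵥ ((fromCols B E * Φ * (fromCols B E)ᵀ) *ᵥ v) =
      (v ᵥ* E) ⬝ᵥ (Φ.toBlocks₂₂ *ᵥ (v ᵥ* E)) := by
    rw [dotProduct_mul_mul_transpose_mulVec, mulVec_transpose, vecMul_fromCols, hv]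
    conv_lhs => rw [← fromBlocks_toBlocks Φ]
    simp [fromBlocks_mulVec, sumElim_dotProduct_sumElim]
  by_contra hE
  have hneg := (posDef_real_iff.1 hΦ).2 _ hE
  rw [neg_mulVec, dotProduct_neg, ← hval] at hneg
  linarith [(posSemidef_real_iff.1 h).2 v]

variable {p m q md N n : ℕ} {Bd0 : Matrix (Fin p) (Fin md) ℝ}
  {Φ : Matrix (Fin md ⊕ Fin N) (Fin md ⊕ Fin N) ℝ}
  {Y : Matrix (Fin p) (Fin N) ℝ} {Xd : Matrix (Fin n) (Fin N) ℝ}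
  {U : Matrix (Fin m) (Fin N) ℝ} {W : Matrix (Fin q) (Fin N) ℝ}

theorem exists_noiseBound_and_eq_mul_iff {ι : Type*} [Finite ι] {B : Matrix ι (Fin md) ℝ}
    (hB : B.rank = md) (hΦ : (-Φ.toBlocks₂₂).PosDef) (E : Matrix ι (Fin N) ℝ) :
    (∃ Ω, NoiseBound Φ Ω ∧ E = B * Ω) ↔
      (fromCols B E * Φ * (fromCols B E)ᵀ).PosSemidef := by
  cases nonempty_fintype ι
  obtain ⟨K, hK⟩ := exists_mul_eq_one_of_rank_eq_card (B := B) (by simpa using hB)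
  have hbound (Ω : Matrix (Fin md) (Fin N) ℝ) :
      (fromCols B (B * Ω) * Φ * (fromCols B (B * Ω))ᵀ).PosSemidef ↔ NoiseBound Φ Ω := by
    have hcols : fromCols B (B * Ω) = B * (fromRows 1 Ωᵀ)ᵀ := by
      rw [transpose_fromRows, mul_fromCols, transpose_one, Matrix.mul_one, transpose_transpose]
    rw [NoiseBound, ← posSemidef_mul_mul_transpose_iff hK, hcols]
    simp only [transpose_mul, transpose_transpose, Matrix.mul_assoc]
  constructor
  · rintro ⟨Ω, hΩ, rfl⟩
    exact (hbound Ω).2 hΩ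
  · intro h
    have hE := eq_mul_mul_of_vecMul_eq_zero hK fun v => vecMul_eq_zero_of_posSemidef hΦ h
    exact ⟨K * E, (hbound _).1 (by rwa [← hE]), hE⟩

theorem matH_isSymm (hΦ : Φ.IsSymm) : (matH Bd0 Φ Y Xd U W).IsSymm :=
  isSymm_mul_mul_transpose hΦ _

theorem posDef_neg_matH_toBlocks₂₂ (hΦ : (-Φ.toBlocks₂₂).PosDef)
    (hrank : (fromRows Xd (fromRows U W)).rank = n + m + q) :
    (-(matH Bd0 Φ Y Xd U W).toBlocks₂₂).PosDef := by
  have hH : -(matH Bd0 Φ Y Xd U W).toBlocks₂₂ =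
      fromRows Xd (fromRows U W) * (-Φ.toBlocks₂₂) * (fromRows Xd (fromRows U W))ᵀ := by
    rw [matH]
    conv_lhs => rw [← fromBlocks_toBlocks Φ]
    rw [fromBlocks_transpose, fromBlocks_multiply, fromBlocks_multiply, toBlocks_fromBlocks₂₂]
    simp only [Matrix.zero_mul, zero_add, transpose_neg, Matrix.mul_neg, Matrix.neg_mul, neg_neg,
      transpose_zero, Matrix.mul_zero]
  rw [hH, ← conjTranspose_eq_transpose_of_trivial]
  exact hΦ.mul_mul_conjTranspose_same (vecMul_injective_iff.2
    (linearIndependent_row_of_rank_eq_card (by simp [hrank, add_assoc])))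

theorem mem_consistentSet_iff (hΦ : (-Φ.toBlocks₂₂).PosDef) (hBd0 : Bd0.rank = md)
    (τ : Matrix (Fin p) (Fin n) ℝ × Matrix (Fin p) (Fin m) ℝ × Matrix (Fin p) (Fin q) ℝ) :
    τ ∈ consistentSet Bd0 Φ Y Xd U W ↔
      (oneCols (fromCols τ.1 (fromCols τ.2.1 τ.2.2)) * matH Bd0 Φ Y Xd U W *
        (oneCols (fromCols τ.1 (fromCols τ.2.1 τ.2.2)))ᵀ).PosSemidef := by
  set Z := fromCols τ.1 (fromCols τ.2.1 τ.2.2) with hZ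
  set E := Y - (τ.1 * Xd + τ.2.1 * U + τ.2.2 * W) with hE
  have hF : oneCols Z * fromBlocks Bd0 Y 0 (-fromRows Xd (fromRows U W)) =
      fromCols Bd0 E := by
    rw [fromCols_mul_fromBlocks, hZ]
    simp only [Matrix.one_mul, Matrix.mul_zero, add_zero, Matrix.mul_neg, fromCols_mul_fromRows,
      hE, sub_eq_add_neg, add_assoc]
  have hH : oneCols Z * matH Bd0 Φ Y Xd U W * (oneCols Z)ᵀ =
      fromCols Bd0 E * Φ * (fromCols Bd0 E)ᵀ := by
    simp only [← hF, matH, transpose_mul, Matrix.mul_assoc]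
  rw [hH, ← exists_noiseBound_and_eq_mul_iff hBd0 hΦ]
  simp only [hE, sub_eq_iff_eq_add', consistentSet, Set.mem_ofPred_eq]

end ConsistentSet

section Center

variable {p : ℕ} {κ : Type*} [Fintype κ] {H : Matrix (Fin p ⊕ κ) (Fin p ⊕ κ) ℝ}

theorem oneCols_mul_mul_transpose (H : Matrix (Fin p ⊕ κ) (Fin p ⊕ κ) ℝ)
    (Z : Matrix (Fin p) κ ℝ) :
    oneCols Z * H * (oneCols Z)ᵀ =
      H.toBlocks₁₁ + Z * H.toBlocks₂₁ + H.toBlocks₁₂ * Zᵀ + Z * H.toBlocks₂₂ * Zᵀ := by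
  conv_lhs => rw [← fromBlocks_toBlocks H]
  rw [fromCols_mul_fromBlocks, transpose_fromCols, fromCols_mul_fromRows]
  simp only [Matrix.one_mul, transpose_one, Matrix.mul_one, Matrix.add_mul]
  abel

variable [DecidableEq κ]

theorem toBlocks₂₂_mul_centerT (h : IsUnit H.toBlocks₂₂) :
    H.toBlocks₂₂ * centerT H = -H.toBlocks₂₁ := by
  rw [centerT, Matrix.mul_neg, mul_nonsing_inv_cancel_left _ _ ((isUnit_iff_isUnit_det _).1 h)]

theorem barHT_eq_zero (h : IsUnit H.toBlocks₂₂) : barHT H = 0 := by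
  have hrows : H.toRows₂ = fromCols H.toBlocks₂₁ H.toBlocks₂₂ := by
    ext i (j | j) <;> rfl
  rw [barHT, colCenter, hrows, fromCols_mul_fromRows, Matrix.mul_one, toBlocks₂₂_mul_centerT h,
    add_neg_cancel]

theorem oneCols_centerT_add_mul_mul_transpose (hH : H.IsSymm) (hu : IsUnit H.toBlocks₂₂)
    (Δ : Matrix (Fin p) κ ℝ) :
    oneCols ((centerT H)ᵀ + Δ) * H * (oneCols ((centerT H)ᵀ + Δ))ᵀ =
      (colCenter H)ᵀ * H * colCenter H + Δ * H.toBlocks₂₂ * Δᵀ := by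
  have h₁₂ : H.toBlocks₁₂ = H.toBlocks₂₁ᵀ := congrArg toBlocks₁₂ hH.eq.symm
  have h₂₂ : H.toBlocks₂₂ᵀ = H.toBlocks₂₂ := congrArg toBlocks₂₂ hH.eq
  have h₂₁ : H.toBlocks₂₁ = -(H.toBlocks₂₂ * centerT H) := by
    rw [toBlocks₂₂_mul_centerT hu, neg_neg]
  have hcenter : (colCenter H)ᵀ * H * colCenter H =
      oneCols (centerT H)ᵀ * H * (oneCols (centerT H)ᵀ)ᵀ := by
    rw [colCenter, transpose_fromCols, transpose_fromRows, transpose_one, transpose_transpose]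
  rw [hcenter, oneCols_mul_mul_transpose, oneCols_mul_mul_transpose, h₁₂, h₂₁]
  simp only [transpose_neg, transpose_mul, transpose_add, transpose_transpose, h₂₂,
    Matrix.mul_add, Matrix.add_mul, Matrix.mul_neg, Matrix.neg_mul, Matrix.mul_assoc]
  abel

theorem center_add_mem_consistentSet_iff {m q md N n pt : ℕ} {Bd0 : Matrix (Fin p) (Fin md) ℝ}
    {Φ : Matrix (Fin md ⊕ Fin N) (Fin md ⊕ Fin N) ℝ}
    {Y : Matrix (Fin p) (Fin N) ℝ} {Xd : Matrix (Fin n) (Fin N) ℝ}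
    {U : Matrix (Fin m) (Fin N) ℝ} {W : Matrix (Fin q) (Fin N) ℝ}
    {H : Matrix (Fin p ⊕ (Fin n ⊕ (Fin m ⊕ Fin q))) (Fin p ⊕ (Fin n ⊕ (Fin m ⊕ Fin q))) ℝ}
    (hBd0 : Bd0.rank = md) (hΦ : Φ.IsSymm) (hΦ22 : (-Φ.toBlocks₂₂).PosDef)
    (hH : H = matH Bd0 Φ Y Xd U W) (hu : IsUnit H.toBlocks₂₂) {Ξ : Matrix (Fin p) (Fin pt) ℝ}
    {Λ : Matrix (Fin pt) (Fin pt) ℝ} (hΞΛ : (colCenter H)ᵀ * H * colCenter H = Ξ * Λ * Ξᵀ)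
    (Δ₁ : Matrix (Fin p) (Fin n) ℝ) (Δ₂ : Matrix (Fin p) (Fin m) ℝ)
    (Δ₃ : Matrix (Fin p) (Fin q) ℝ) :
    (checkAs H + Δ₁, checkBu0 H + Δ₂, checkBw0 H + Δ₃) ∈ consistentSet Bd0 Φ Y Xd U W ↔
      (Ξ * Λ * Ξᵀ - fromCols Δ₁ (fromCols Δ₂ Δ₃) * (-H.toBlocks₂₂) *
        (fromCols Δ₁ (fromCols Δ₂ Δ₃))ᵀ).PosSemidef := by
  have hcols : fromCols (checkAs H + Δ₁) (fromCols (checkBu0 H + Δ₂) (checkBw0 H + Δ₃)) =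
      (centerT H)ᵀ + fromCols Δ₁ (fromCols Δ₂ Δ₃) := by
    ext i (j | j | j) <;> rfl
  rw [mem_consistentSet_iff hΦ22 hBd0, hcols, ← hH,
    oneCols_centerT_add_mul_mul_transpose (hH ▸ matH_isSymm hΦ) hu, hΞΛ, Matrix.mul_neg,
    Matrix.neg_mul, sub_neg_eq_add]

end Center

section Kernel

variable {r p n : ℕ} {L1 : Matrix (Fin r) (Fin n) ℝ} {X : Matrix (Fin p) (Fin n) ℝ}

theorem RowsBasisOfKer.mul_transpose (h : RowsBasisOfKer L1 X) : X * L1ᵀ = 0 := by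
  ext i j
  have hj : L1.row j ∈ LinearMap.ker X.mulVecLin := h.2 ▸ Submodule.subset_span ⟨j, rfl⟩
  exact congrFun (LinearMap.mem_ker.1 hj) i

theorem RowsBasisOfKer.add_eq (h : RowsBasisOfKer L1 X) (hX : LinearIndependent ℝ X.row) :
    r + p = n := by
  have hker : Module.finrank ℝ (LinearMap.ker X.mulVecLin) = r := by
    rw [← h.2, finrank_span_eq_card h.1, Fintype.card_fin]
  have hrange : Module.finrank ℝ (LinearMap.range X.mulVecLin) = p :=
    hX.rank_matrix.trans (Fintype.card_fin p)
  have hdim := LinearMap.finrank_range_add_finrank_ker X.mulVecLin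
  rwa [hker, hrange, Module.finrank_fin_fun, add_comm] at hdim

theorem rectInv_matL (hL1 : RowsBasisOfKer L1 X) (hX : LinearIndependent ℝ X.row) :
    rectInv (matL L1 X) = fromCols (L1ᵀ * (L1 * L1ᵀ)⁻¹) Xᵀ := by
  have hXL := hL1.mul_transpose
  have hLX : L1 * Xᵀ = 0 := by simpa using congrArg transpose hXL
  have hLu := (isUnit_iff_isUnit_det _).1 (isUnit_mul_transpose hL1.1)
  have hXu := (isUnit_iff_isUnit_det _).1 (isUnit_mul_transpose hX)
  have hmul : matL L1 X * fromCols (L1ᵀ * (L1 * L1ᵀ)⁻¹) Xᵀ = 1 := by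
    rw [matL, fromRows_mul_fromCols, ← Matrix.mul_assoc, hLX, Matrix.mul_assoc _ X Xᵀ,
      mul_nonsing_inv _ hLu, nonsing_inv_mul _ hXu, Matrix.mul_assoc _ X, ← Matrix.mul_assoc X,
      hXL, Matrix.zero_mul, Matrix.mul_zero, fromBlocks_one]
  refine rectInv_eq hmul ((mul_eq_one_comm_of_card_eq _ _ _ ?_).1 hmul)
  simp [← hL1.add_eq hX]

theorem linearIndependent_toRows₁_row_of_isCompactSVD {κ : Type*} [Fintype κ] [DecidableEq κ]
    {N : ℕ} {X : Matrix (Fin p ⊕ κ) (Fin N) ℝ} {Xs : Matrix (Fin p ⊕ κ) (Fin n) ℝ}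
    {σ : Fin n → ℝ} {Xr : Matrix (Fin N) (Fin n) ℝ} (hSVD : IsCompactSVD X Xs σ Xr)
    (hX : LinearIndependent ℝ X.toRows₁.row) : LinearIndependent ℝ Xs.toRows₁.row := by
  have hfactor : X.toRows₁ = Xs.toRows₁ * (diagonal σ * Xrᵀ) := by
    rw [hSVD.2.2.2, Matrix.mul_assoc]
    rfl
  rw [← vecMul_injective_iff] at hX ⊢
  refine Function.Injective.of_comp (f := (· ᵥ* (diagonal σ * Xrᵀ))) ?_
  convert hX using 2
  simp [hfactor, ← vecMul_vecMul]

end Kernel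

section ClosedLoop

variable {l p m q n pc pz pzt pt : ℕ}

/-- The state matrix of the closed loop of the plant `(A, B, C)` and the controller
`(Ac, Bc, Cc, Dc)`. -/
def closedA (A : Matrix (Fin n) (Fin n) ℝ) (B : Matrix (Fin n) (Fin m) ℝ)
    (C : Matrix (Fin pc) (Fin n) ℝ) (Ac : Matrix (Fin n) (Fin n) ℝ)
    (Bc : Matrix (Fin n) (Fin pc) ℝ) (Cc : Matrix (Fin m) (Fin n) ℝ)
    (Dc : Matrix (Fin m) (Fin pc) ℝ) : Matrix (Fin n ⊕ Fin n) (Fin n ⊕ Fin n) ℝ :=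
  fromBlocks (A + B * Dc * C) (B * Cc) (Bc * C) Ac

/-- The gain from the closed-loop state to the signal `col(x, u, w)` on which a deviation of the
triple `(Ā_s, B_{u0}, B_{w0})` acts. -/
def uncX (C : Matrix (Fin pc) (Fin n) ℝ) (Cc : Matrix (Fin m) (Fin n) ℝ)
    (Dc : Matrix (Fin m) (Fin pc) ℝ) (q : ℕ) :
    Matrix (Fin n ⊕ (Fin m ⊕ Fin q)) (Fin n ⊕ Fin n) ℝ :=
  fromRows (fromCols 1 0) (fromRows (fromCols (Dc * C) Cc) (fromCols 0 0))

/-- The gain from the disturbance to the signal `col(x, u, w)` on which a deviation of the triple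
`(Ā_s, B_{u0}, B_{w0})` acts. -/
def uncW (n m q : ℕ) : Matrix (Fin n ⊕ (Fin m ⊕ Fin q)) (Fin q) ℝ :=
  fromRows 0 (fromRows 0 1)

/-- The gain from a deviation of the first `p` state equations to the closed-loop state. -/
def uncIn (Xs : Matrix (StateIdx l p m q) (Fin n) ℝ) : Matrix (Fin n ⊕ Fin n) (Fin p) ℝ :=
  fromRows Xs.toRows₁ᵀ 0

/-- The `robustLMI` of the closed loop: the nominal plant is the center of the consistent set, the
uncertainty is the deviation of a triple from that center. -/
noncomputable def closedLoopLMI (P : Matrix (Fin n ⊕ Fin n) (Fin n ⊕ Fin n) ℝ)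
    (Xs : Matrix (StateIdx l p m q) (Fin n) ℝ)
    (H : Matrix (Fin p ⊕ (Fin n ⊕ (Fin m ⊕ Fin q))) (Fin p ⊕ (Fin n ⊕ (Fin m ⊕ Fin q))) ℝ)
    (Ξ : Matrix (Fin p) (Fin pt) ℝ) (Λ : Matrix (Fin pt) (Fin pt) ℝ)
    (C : Matrix (Fin pc) (Fin n) ℝ) (C1 : Matrix (Fin pz) (Fin n) ℝ)
    (E : Matrix (Fin pz) (Fin m) ℝ) (D1 : Matrix (Fin pz) (Fin q) ℝ)
    (Q : Matrix (Fin q) (Fin q) ℝ) (S : Matrix (Fin q) (Fin pz) ℝ)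
    (T : Matrix (Fin pz) (Fin pzt) ℝ) (Rt : Matrix (Fin pzt) (Fin pzt) ℝ)
    (Ac : Matrix (Fin n) (Fin n) ℝ) (Bc : Matrix (Fin n) (Fin pc) ℝ)
    (Cc : Matrix (Fin m) (Fin n) ℝ) (Dc : Matrix (Fin m) (Fin pc) ℝ) (α : ℝ) :
    Matrix (((Fin n ⊕ Fin n) ⊕ (Fin q ⊕ Fin pzt)) ⊕
        ((Fin n ⊕ Fin n) ⊕ ((Fin n ⊕ (Fin m ⊕ Fin q)) ⊕ Fin pt)))
      (((Fin n ⊕ Fin n) ⊕ (Fin q ⊕ Fin pzt)) ⊕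
        ((Fin n ⊕ Fin n) ⊕ ((Fin n ⊕ (Fin m ⊕ Fin q)) ⊕ Fin pt))) ℝ :=
  robustLMI P (closedA (redA Xs (checkAs H)) (redB Xs (checkBu0 H)) C Ac Bc Cc Dc)
    (fromRows (redB1 Xs (checkBw0 H)) 0) (fromCols (C1 + E * Dc * C) (E * Cc)) D1 Q S T Rt
    (uncIn Xs) (uncX C Cc Dc q) (uncW n m q) (-H.toBlocks₂₂) Ξ Λ α

variable {Xs : Matrix (StateIdx l p m q) (Fin n) ℝ} {C : Matrix (Fin pc) (Fin n) ℝ}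
  {C1 : Matrix (Fin pz) (Fin n) ℝ} {E : Matrix (Fin pz) (Fin m) ℝ}
  {D1 : Matrix (Fin pz) (Fin q) ℝ} {Q : Matrix (Fin q) (Fin q) ℝ}
  {S : Matrix (Fin q) (Fin pz) ℝ} {T : Matrix (Fin pz) (Fin pzt) ℝ}
  {Rt : Matrix (Fin pzt) (Fin pzt) ℝ} {Ac : Matrix (Fin n) (Fin n) ℝ}
  {Bc : Matrix (Fin n) (Fin pc) ℝ} {Cc : Matrix (Fin m) (Fin n) ℝ}
  {Dc : Matrix (Fin m) (Fin pc) ℝ}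

theorem transpose_mul_fromRows_add {μ : Type*} (Xs : Matrix (StateIdx l p m q) (Fin n) ℝ)
    (As Δ : Matrix (Fin p) μ ℝ) (J : Matrix (RestIdx l p m q) μ ℝ) :
    Xsᵀ * fromRows (As + Δ) J = Xsᵀ * fromRows As J + Xs.toRows₁ᵀ * Δ := by
  have hXs : Xsᵀ = fromCols Xs.toRows₁ᵀ Xs.toRows₂ᵀ := by
    rw [← transpose_fromRows, fromRows_toRows]
  rw [hXs, fromCols_mul_fromRows, fromCols_mul_fromRows, Matrix.mul_add]
  abel

theorem closedA_add (As Δ₁ : Matrix (Fin p) (Fin n) ℝ) (Bu Δ₂ : Matrix (Fin p) (Fin m) ℝ)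
    (Δ₃ : Matrix (Fin p) (Fin q) ℝ) :
    closedA (redA Xs (As + Δ₁)) (redB Xs (Bu + Δ₂)) C Ac Bc Cc Dc =
      closedA (redA Xs As) (redB Xs Bu) C Ac Bc Cc Dc +
        uncIn Xs * fromCols Δ₁ (fromCols Δ₂ Δ₃) * uncX C Cc Dc q := by
  simp only [closedA, uncIn, uncX, redA, redB, transpose_mul_fromRows_add, fromRows_mul,
    Matrix.zero_mul, Matrix.mul_assoc, fromCols_mul_fromRows, mul_fromCols, Matrix.mul_one,
    Matrix.mul_zero, fromCols_zero, add_zero]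
  ext (i | i) (j | j) <;> simp [Matrix.add_mul, Matrix.mul_assoc]
  ring

theorem closedB_add (Δ₁ : Matrix (Fin p) (Fin n) ℝ) (Δ₂ : Matrix (Fin p) (Fin m) ℝ)
    (Bw Δ₃ : Matrix (Fin p) (Fin q) ℝ) :
    fromRows (redB1 Xs (Bw + Δ₃)) (0 : Matrix (Fin n) (Fin q) ℝ) =
      fromRows (redB1 Xs Bw) 0 + uncIn Xs * fromCols Δ₁ (fromCols Δ₂ Δ₃) * uncW n m q := by
  simp only [uncIn, uncW, redB1, transpose_mul_fromRows_add, fromRows_mul,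
    Matrix.zero_mul, Matrix.mul_assoc, fromCols_mul_fromRows, Matrix.mul_one,
    Matrix.mul_zero, zero_add]
  ext (i | i) j <;> simp

theorem robustDissipative_iff {md N : ℕ} {Bd0 : Matrix (Fin p) (Fin md) ℝ}
    {Φ : Matrix (Fin md ⊕ Fin N) (Fin md ⊕ Fin N) ℝ}
    {Y : Matrix (Fin p) (Fin N) ℝ} {Xd : Matrix (Fin n) (Fin N) ℝ}
    {U : Matrix (Fin m) (Fin N) ℝ} {W : Matrix (Fin q) (Fin N) ℝ}
    {H : Matrix (Fin p ⊕ (Fin n ⊕ (Fin m ⊕ Fin q))) (Fin p ⊕ (Fin n ⊕ (Fin m ⊕ Fin q))) ℝ}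
    {Ξ : Matrix (Fin p) (Fin pt) ℝ} {Λ : Matrix (Fin pt) (Fin pt) ℝ}
    (hBd0 : Bd0.rank = md) (hΦ : Φ.IsSymm) (hΦ22 : (-Φ.toBlocks₂₂).PosDef)
    (hrank : (fromRows Xd (fromRows U W)).rank = n + m + q)
    (hH : H = matH Bd0 Φ Y Xd U W) (hRt : Rt.PosDef) (hΛ : Λ.PosDef)
    (hΞΛ : (colCenter H)ᵀ * H * colCenter H = Ξ * Λ * Ξᵀ)
    (P : Matrix (Fin n ⊕ Fin n) (Fin n ⊕ Fin n) ℝ) :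
    RobustDissipative Xs (consistentSet Bd0 Φ Y Xd U W) C C1 E D1 Q S (T * Rt * Tᵀ) Ac Bc Cc Dc P ↔
      P.PosDef ∧ ∃ α, (closedLoopLMI P Xs H Ξ Λ C C1 E D1 Q S T Rt Ac Bc Cc Dc α).PosDef := by
  have hN : (-H.toBlocks₂₂).PosDef := hH ▸ posDef_neg_matH_toBlocks₂₂ hΦ22 hrank
  have hu : IsUnit H.toBlocks₂₂ := by simpa using hN.isUnit.neg
  have hmem := center_add_mem_consistentSet_iff hBd0 hΦ hΦ22 hH hu hΞΛ
  refine and_congr_right fun hP =>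
    Iff.trans ?_ (forall_dissipationIneq_iff_exists_robustLMI hP hRt hN hΛ)
  constructor
  · intro h Δ hΔ
    obtain ⟨Δ₁, Δ₂, Δ₃, rfl⟩ : ∃ Δ₁ Δ₂ Δ₃, Δ = fromCols Δ₁ (fromCols Δ₂ Δ₃) :=
      ⟨_, _, _, by rw [fromCols_toCols, fromCols_toCols]⟩
    have hdiss := h _ ((hmem Δ₁ Δ₂ Δ₃).2 hΔ)
    rw [← closedA_add, ← closedB_add]
    exact hdiss
  · rintro h ⟨As, Bu, Bw⟩ hτ
    obtain ⟨Δ₁, rfl⟩ : ∃ Δ, As = checkAs H + Δ := ⟨_, (add_sub_cancel _ _).symm⟩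
    obtain ⟨Δ₂, rfl⟩ : ∃ Δ, Bu = checkBu0 H + Δ := ⟨_, (add_sub_cancel _ _).symm⟩
    obtain ⟨Δ₃, rfl⟩ : ∃ Δ, Bw = checkBw0 H + Δ := ⟨_, (add_sub_cancel _ _).symm⟩
    have hdiss := h _ ((hmem Δ₁ Δ₂ Δ₃).1 hτ)
    rwa [← closedA_add, ← closedB_add] at hdiss

end ClosedLoop

section Synthesis

variable {l p m q n pc pz pzt pt r : ℕ}

/-- The nonlinear change of variables that turns the controller `(Ac, Bc, Cc, Dc)` of the plant
`(A, B, C)` into the variables `(Ãc, B̃c, C̃c, Dc)` in which the synthesis inequality is affine. -/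
structure IsControllerTransform (A : Matrix (Fin n) (Fin n) ℝ) (B : Matrix (Fin n) (Fin m) ℝ)
    (C : Matrix (Fin pc) (Fin n) ℝ) (X Y U VT Ac : Matrix (Fin n) (Fin n) ℝ)
    (Bc : Matrix (Fin n) (Fin pc) ℝ) (Cc : Matrix (Fin m) (Fin n) ℝ)
    (Dc : Matrix (Fin m) (Fin pc) ℝ) (Act : Matrix (Fin n) (Fin n) ℝ)
    (Bct : Matrix (Fin n) (Fin pc) ℝ) (Cct : Matrix (Fin m) (Fin n) ℝ) : Prop where
  state_eq : Act = X * (A * Y + B * Cct) + U * Bc * C * Y + U * Ac * VT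
  input_eq : Bct = X * B * Dc + U * Bc
  output_eq : Cct = Dc * C * Y + Cc * VT

/-- The block diagonal matrix `diag(V, I)` whose identity block is indexed by `κ`. -/
def blockDiagOne {ι : Type*} (V : Matrix ι ι ℝ) (κ : Type*) [DecidableEq κ] :
    Matrix (ι ⊕ κ) (ι ⊕ κ) ℝ :=
  fromBlocks V 0 0 1

theorem transpose_blockDiagOne_mul_fromBlocks_mul {ι₁ ι₂ κ₁ κ₂ : Type*} [Fintype ι₁] [Fintype ι₂]
    [Fintype κ₁] [DecidableEq κ₁] [Fintype κ₂] [DecidableEq κ₂] (V₁ : Matrix ι₁ ι₁ ℝ)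
    (V₂ : Matrix ι₂ ι₂ ℝ) (F₁₁ : Matrix ι₁ ι₂ ℝ) (F₁₂ : Matrix ι₁ κ₂ ℝ) (F₂₁ : Matrix κ₁ ι₂ ℝ)
    (F₂₂ : Matrix κ₁ κ₂ ℝ) :
    (blockDiagOne V₁ κ₁)ᵀ * fromBlocks F₁₁ F₁₂ F₂₁ F₂₂ * blockDiagOne V₂ κ₂ =
      fromBlocks (V₁ᵀ * F₁₁ * V₂) (V₁ᵀ * F₁₂) (F₂₁ * V₂) F₂₂ := by
  rw [blockDiagOne, blockDiagOne, fromBlocks_transpose, fromBlocks_multiply, fromBlocks_multiply]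
  simp

/-- The congruence factor that takes `closedLoopLMI` to `matPi`. -/
def synthesisFactor (Y VT : Matrix (Fin n) (Fin n) ℝ) (κ₁ κ₂ : Type*) [DecidableEq κ₁]
    [DecidableEq κ₂] :
    Matrix (((Fin n ⊕ Fin n) ⊕ κ₁) ⊕ ((Fin n ⊕ Fin n) ⊕ κ₂))
      (((Fin n ⊕ Fin n) ⊕ κ₁) ⊕ ((Fin n ⊕ Fin n) ⊕ κ₂)) ℝ :=
  fromBlocks (blockDiagOne (fromBlocks 1 Y 0 VT) κ₁) 0 0
    (blockDiagOne (fromBlocks Y 1 VT 0) κ₂)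

theorem isUnit_synthesisFactor (Y : Matrix (Fin n) (Fin n) ℝ) {VT : Matrix (Fin n) (Fin n) ℝ}
    (hVT : IsUnit VT) (κ₁ κ₂ : Type*) [Fintype κ₁] [DecidableEq κ₁] [Fintype κ₂]
    [DecidableEq κ₂] : IsUnit (synthesisFactor Y VT κ₁ κ₂) :=
  isUnit_fromBlocks_zero₂₁.2
    ⟨isUnit_fromBlocks_zero₂₁.2 ⟨isUnit_fromBlocks_zero₂₁.2 ⟨isUnit_one, hVT⟩, isUnit_one⟩,
      isUnit_fromBlocks_zero₂₁.2 ⟨isUnit_fromBlocks_one_zero Y hVT, isUnit_one⟩⟩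

variable {A : Matrix (Fin n) (Fin n) ℝ} {B : Matrix (Fin n) (Fin m) ℝ}
  {B1 : Matrix (Fin n) (Fin q) ℝ} {Xs : Matrix (StateIdx l p m q) (Fin n) ℝ}
  {C : Matrix (Fin pc) (Fin n) ℝ} {C1 : Matrix (Fin pz) (Fin n) ℝ}
  {E : Matrix (Fin pz) (Fin m) ℝ}
  {D1 : Matrix (Fin pz) (Fin q) ℝ} {Q : Matrix (Fin q) (Fin q) ℝ}
  {S : Matrix (Fin q) (Fin pz) ℝ} {T : Matrix (Fin pz) (Fin pzt) ℝ}
  {Rt : Matrix (Fin pzt) (Fin pzt) ℝ} {X Y U VT : Matrix (Fin n) (Fin n) ℝ}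
  {Ac Act : Matrix (Fin n) (Fin n) ℝ} {Bc Bct : Matrix (Fin n) (Fin pc) ℝ}
  {Cc Cct : Matrix (Fin m) (Fin n) ℝ} {Dc : Matrix (Fin m) (Fin pc) ℝ}
  {P : Matrix (Fin n ⊕ Fin n) (Fin n ⊕ Fin n) ℝ}
  {H : Matrix (Fin p ⊕ (Fin n ⊕ (Fin m ⊕ Fin q))) (Fin p ⊕ (Fin n ⊕ (Fin m ⊕ Fin q))) ℝ}
  {L1 : Matrix (Fin r) (Fin n) ℝ} {Ξ : Matrix (Fin p) (Fin pt) ℝ}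
  {Λ : Matrix (Fin pt) (Fin pt) ℝ} {α : ℝ}

theorem isControllerTransform_of_eq (hU : IsUnit U) (hVT : IsUnit VT)
    (hBc : Bc = U⁻¹ * (Bct - X * B * Dc)) (hCc : Cc = (Cct - Dc * C * Y) * VT⁻¹)
    (hAc : Ac = U⁻¹ * (Act - X * (A * Y + B * Cct) - U * Bc * C * Y) * VT⁻¹) :
    IsControllerTransform A B C X Y U VT Ac Bc Cc Dc Act Bct Cct := by
  have hUd := (isUnit_iff_isUnit_det _).1 hU
  have hVTd := (isUnit_iff_isUnit_det _).1 hVT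
  constructor
  · rw [hAc, Matrix.mul_assoc U⁻¹, mul_nonsing_inv_cancel_left _ _ hUd,
      nonsing_inv_mul_cancel_right _ _ hVTd]
    abel
  · rw [hBc, mul_nonsing_inv_cancel_left _ _ hUd]
    abel
  · rw [hCc, nonsing_inv_mul_cancel_right _ _ hVTd]
    abel

namespace IsControllerTransform

variable (h : IsControllerTransform A B C X Y U VT Ac Bc Cc Dc Act Bct Cct)
include h

theorem mul_closedA_mul :
    fromBlocks 1 0 X U * closedA A B C Ac Bc Cc Dc * fromBlocks 1 Y 0 VT =
      fromBlocks (A + B * Dc * C) (A * Y + B * Cct) (X * A + Bct * C) Act := by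
  rw [closedA, fromBlocks_multiply, fromBlocks_multiply, h.state_eq, h.input_eq, h.output_eq]
  congr 1 <;> simp only [Matrix.one_mul, Matrix.zero_mul, Matrix.mul_one, Matrix.mul_zero,
    add_zero, Matrix.mul_add, Matrix.add_mul, Matrix.mul_assoc] <;> abel

theorem uncX_mul : uncX C Cc Dc q * fromBlocks 1 Y 0 VT =
    fromRows (fromCols 1 Y) (fromRows (fromCols (Dc * C) Cct) (fromCols 0 0)) := by
  simp [uncX, fromRows_mul, fromCols_mul_fromBlocks, h.output_eq]

theorem performance_mul :
    fromCols (C1 + E * Dc * C) (E * Cc) * fromBlocks 1 Y 0 VT =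
      fromCols (C1 + E * Dc * C) (C1 * Y + E * Cct) := by
  rw [fromCols_mul_fromBlocks, h.output_eq]
  simp [Matrix.mul_add, Matrix.add_mul, Matrix.mul_assoc, add_assoc]

theorem matPi11_eq (hP : IsStoragePartition P X Y U VT) :
    matPi11 C C1 E D1 Q S T Rt X Y Cct Dc =
      (blockDiagOne (fromBlocks 1 Y 0 VT) (Fin q ⊕ Fin pzt))ᵀ *
        supplyLMI P (fromCols (C1 + E * Dc * C) (E * Cc)) D1 Q S T Rt *
        blockDiagOne (fromBlocks 1 Y 0 VT) (Fin q ⊕ Fin pzt) := by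
  have hG : fromRows (-(S * fromCols (C1 + E * Dc * C) (E * Cc)))
      (Tᵀ * fromCols (C1 + E * Dc * C) (E * Cc)) * fromBlocks 1 Y 0 VT =
      fromBlocks (-(S * (C1 + E * Dc * C))) (-(S * (C1 * Y + E * Cct)))
        (Tᵀ * (C1 + E * Dc * C)) (Tᵀ * (C1 * Y + E * Cct)) := by
    rw [fromRows_mul, Matrix.neg_mul, Matrix.mul_assoc S, Matrix.mul_assoc Tᵀ, h.performance_mul,
      mul_fromCols, mul_fromCols, fromCols_neg, fromRows_fromCols_eq_fromBlocks]
  rw [supplyLMI, transpose_blockDiagOne_mul_fromBlocks_mul, ← transpose_mul, hG,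
    hP.transpose_mul_mul]
  rfl

theorem matPi12T_eq (hP : IsStoragePartition P X Y U VT) :
    matPi12T pzt pt C A B B1 X Y Act Bct Cct Dc =
      (blockDiagOne (fromBlocks Y 1 VT 0) ((Fin n ⊕ (Fin m ⊕ Fin q)) ⊕ Fin pt))ᵀ *
        robustLMI₂₁ (φ := Fin pt) (ζ := Fin pzt) P (closedA A B C Ac Bc Cc Dc) (fromRows B1 0)
          (uncX C Cc Dc q) (uncW n m q) *
        blockDiagOne (fromBlocks 1 Y 0 VT) (Fin q ⊕ Fin pzt) := by
  have hB : (fromBlocks Y 1 VT 0)ᵀ *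
      fromCols (P * fromRows B1 (0 : Matrix (Fin n) (Fin q) ℝ))
        (0 : Matrix (Fin n ⊕ Fin n) (Fin pzt) ℝ) = fromBlocks B1 0 (X * B1) 0 := by
    rw [mul_fromCols, ← Matrix.mul_assoc, hP.transpose_fromBlocks_mul, hP.blocks.1.eq,
      fromBlocks_mul_fromRows, Matrix.mul_zero]
    ext (i | i) (j | j) <;> simp
  have hW : fromCols (uncW n m q) (0 : Matrix _ (Fin pzt) ℝ) =
      fromRows (fromCols 0 0) (fromRows (fromCols 0 0) (fromCols 1 0)) := by
    ext (i | i | i) (j | j) <;> rfl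
  have hblocks : robustLMI₂₁ (φ := Fin pt) (ζ := Fin pzt) P (closedA A B C Ac Bc Cc Dc)
      (fromRows B1 0) (uncX C Cc Dc q) (uncW n m q) = fromBlocks (P * closedA A B C Ac Bc Cc Dc)
        (fromCols (P * fromRows B1 (0 : Matrix (Fin n) (Fin q) ℝ)) (0 : Matrix _ (Fin pzt) ℝ))
        (fromRows (uncX C Cc Dc q) (0 : Matrix (Fin pt) _ ℝ))
        (fromRows (fromCols (uncW n m q) 0) 0) := by
    ext (i | i | i) (j | j | j) <;> rfl
  rw [hblocks, transpose_blockDiagOne_mul_fromBlocks_mul, hB, hW, fromRows_mul, h.uncX_mul,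
    ← Matrix.mul_assoc, hP.transpose_fromBlocks_mul, hP.blocks.1.eq, h.mul_closedA_mul,
    Matrix.zero_mul]
  rfl

end IsControllerTransform

theorem matPi22_eq (hP : IsStoragePartition P X Y U VT) (hu : IsUnit H.toBlocks₂₂)
    (hL1 : RowsBasisOfKer L1 Xs.toRows₁) (hXs : LinearIndependent ℝ Xs.toRows₁.row) :
    matPi22 H (matL L1 Xs.toRows₁) Ξ Λ α X Y =
      (blockDiagOne (fromBlocks Y 1 VT 0) ((Fin n ⊕ (Fin m ⊕ Fin q)) ⊕ Fin pt))ᵀ *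
        robustLMI₂₂ P (uncIn Xs) (-H.toBlocks₂₂) Ξ Λ α *
        blockDiagOne (fromBlocks Y 1 VT 0) ((Fin n ⊕ (Fin m ⊕ Fin q)) ⊕ Fin pt) := by
  have hF : fromCols (0 : Matrix (Fin pt) (Fin r) ℝ) (α • Ξᵀ) *
      (fromCols (L1ᵀ * (L1 * L1ᵀ)⁻¹) Xs.toRows₁ᵀ)ᵀ = α • (Xs.toRows₁ᵀ * Ξ)ᵀ := by
    rw [transpose_fromCols, fromCols_mul_fromRows, Matrix.zero_mul, zero_add,
      transpose_transpose, transpose_mul, transpose_transpose, Matrix.smul_mul]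
  have hG : (P * uncIn Xs * Ξ)ᵀ * fromBlocks Y 1 VT 0 =
      fromCols (Xs.toRows₁ᵀ * Ξ)ᵀ ((Xs.toRows₁ᵀ * Ξ)ᵀ * X) := by
    rw [transpose_mul, transpose_mul, hP.isSymm.eq, Matrix.mul_assoc, Matrix.mul_assoc, hP.mul_eq,
      uncIn, transpose_fromRows, fromCols_mul_fromBlocks]
    simp [transpose_mul, mul_fromCols, Matrix.mul_assoc]
  have hαG : (α • (P * uncIn Xs * Ξ)ᵀ) * fromBlocks Y 1 VT 0 =
      fromCols (α • (Xs.toRows₁ᵀ * Ξ)ᵀ) (α • (Xs.toRows₁ᵀ * Ξ)ᵀ * X) := by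
    rw [Matrix.smul_mul, hG]
    ext i (j | j) <;> simp
  rw [robustLMI₂₂, transpose_blockDiagOne_mul_fromBlocks_mul, ← transpose_mul,
    hP.transpose_mul_mul_swap, fromRows_mul, hαG, Matrix.zero_mul, ← fromCols_zero,
    fromRows_fromCols_eq_fromBlocks]
  simp only [matPi22]
  rw [barHT_eq_zero hu, rectInv_matL hL1 hXs, hF]
  simp

theorem matPi_eq_congruence (hu : IsUnit H.toBlocks₂₂) (hL1 : RowsBasisOfKer L1 Xs.toRows₁)
    (hXs : LinearIndependent ℝ Xs.toRows₁.row) (hP : IsStoragePartition P X Y U VT)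
    (h : IsControllerTransform (redA Xs (checkAs H)) (redB Xs (checkBu0 H)) C X Y U VT
      Ac Bc Cc Dc Act Bct Cct) :
    matPi Xs H L1 Ξ Λ C C1 E D1 Q S T Rt α X Y Act Bct Cct Dc =
      (synthesisFactor Y VT _ _)ᵀ * closedLoopLMI P Xs H Ξ Λ C C1 E D1 Q S T Rt Ac Bc Cc Dc α *
        synthesisFactor Y VT _ _ := by
  rw [matPi, h.matPi11_eq hP, h.matPi12T_eq hP, matPi22_eq hP hu hL1 hXs, closedLoopLMI, robustLMI,
    synthesisFactor]
  rw [fromBlocks_transpose, fromBlocks_multiply, fromBlocks_multiply]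
  simp [transpose_mul, Matrix.mul_assoc]

theorem posDef_matPi_iff (hu : IsUnit H.toBlocks₂₂) (hL1 : RowsBasisOfKer L1 Xs.toRows₁)
    (hXs : LinearIndependent ℝ Xs.toRows₁.row) (hP : IsStoragePartition P X Y U VT)
    (hVT : IsUnit VT)
    (h : IsControllerTransform (redA Xs (checkAs H)) (redB Xs (checkBu0 H)) C X Y U VT
      Ac Bc Cc Dc Act Bct Cct) :
    (matPi Xs H L1 Ξ Λ C C1 E D1 Q S T Rt α X Y Act Bct Cct Dc).PosDef ↔
      (closedLoopLMI P Xs H Ξ Λ C C1 E D1 Q S T Rt Ac Bc Cc Dc α).PosDef := by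
  rw [matPi_eq_congruence hu hL1 hXs hP h, ← conjTranspose_eq_transpose_of_trivial,
    ← star_eq_conjTranspose, IsUnit.posDef_star_left_conjugate_iff]
  exact isUnit_synthesisFactor Y hVT _ _

end Synthesis

section Equivalence

variable {l p m q n pc pz pzt pt r : ℕ} {Xs : Matrix (StateIdx l p m q) (Fin n) ℝ}
  {C : Matrix (Fin pc) (Fin n) ℝ} {C1 : Matrix (Fin pz) (Fin n) ℝ}
  {E : Matrix (Fin pz) (Fin m) ℝ} {D1 : Matrix (Fin pz) (Fin q) ℝ}
  {Q : Matrix (Fin q) (Fin q) ℝ} {S : Matrix (Fin q) (Fin pz) ℝ}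
  {T : Matrix (Fin pz) (Fin pzt) ℝ} {Rt : Matrix (Fin pzt) (Fin pzt) ℝ}
  {Ac : Matrix (Fin n) (Fin n) ℝ} {Bc : Matrix (Fin n) (Fin pc) ℝ}
  {Cc : Matrix (Fin m) (Fin n) ℝ} {Dc : Matrix (Fin m) (Fin pc) ℝ}
  {H : Matrix (Fin p ⊕ (Fin n ⊕ (Fin m ⊕ Fin q))) (Fin p ⊕ (Fin n ⊕ (Fin m ⊕ Fin q))) ℝ}
  {L1 : Matrix (Fin r) (Fin n) ℝ} {Ξ : Matrix (Fin p) (Fin pt) ℝ}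
  {Λ : Matrix (Fin pt) (Fin pt) ℝ} {α : ℝ}

theorem exists_posDef_matPi_of_posDef_closedLoopLMI {P : Matrix (Fin n ⊕ Fin n) (Fin n ⊕ Fin n) ℝ}
    (hu : IsUnit H.toBlocks₂₂) (hL1 : RowsBasisOfKer L1 Xs.toRows₁)
    (hXs : LinearIndependent ℝ Xs.toRows₁.row) (hP : P.PosDef)
    (h : (closedLoopLMI P Xs H Ξ Λ C C1 E D1 Q S T Rt Ac Bc Cc Dc α).PosDef) :
    ∃ (X Y Act : Matrix (Fin n) (Fin n) ℝ) (Bct : Matrix (Fin n) (Fin pc) ℝ)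
      (Cct : Matrix (Fin m) (Fin n) ℝ), X.IsSymm ∧ Y.IsSymm ∧
        (matPi Xs H L1 Ξ Λ C C1 E D1 Q S T Rt α X Y Act Bct Cct Dc).PosDef := by
  obtain ⟨P', hP', hU, hpos⟩ := exists_posDef_robustLMI_isUnit_toBlocks₁₂ hP h
  have hpart := isStoragePartition_of_posDef hP'
  exact ⟨_, _, _, _, _, hpart.blocks.1, hpart.blocks.2.1,
    (posDef_matPi_iff hu hL1 hXs hpart (hpart.isUnit hU) ⟨rfl, rfl, rfl⟩).2 hpos⟩

theorem exists_posDef_closedLoopLMI_of_posDef_matPi {X Y Act U VT : Matrix (Fin n) (Fin n) ℝ}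
    {Bct : Matrix (Fin n) (Fin pc) ℝ} {Cct : Matrix (Fin m) (Fin n) ℝ}
    (hu : IsUnit H.toBlocks₂₂) (hL1 : RowsBasisOfKer L1 Xs.toRows₁)
    (hXs : LinearIndependent ℝ Xs.toRows₁.row)
    (hpos : (matPi Xs H L1 Ξ Λ C C1 E D1 Q S T Rt α X Y Act Bct Cct Dc).PosDef)
    (hU : IsUnit U) (hVT : VT = U⁻¹ * (1 - X * Y))
    (hBc : Bc = U⁻¹ * (Bct - X * redB Xs (checkBu0 H) * Dc))
    (hCc : Cc = (Cct - Dc * C * Y) * VT⁻¹)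
    (hAc : Ac = U⁻¹ * (Act - X * (redA Xs (checkAs H) * Y + redB Xs (checkBu0 H) * Cct)
      - U * Bc * C * Y) * VT⁻¹) :
    IsUnit VT ∧ ∃ P : Matrix (Fin n ⊕ Fin n) (Fin n ⊕ Fin n) ℝ, P.PosDef ∧
      (closedLoopLMI P Xs H Ξ Λ C C1 E D1 Q S T Rt Ac Bc Cc Dc α).PosDef := by
  have hXY : (fromBlocks X 1 1 Y).PosDef :=
    hpos.submatrix (e := fun i => Sum.inl (Sum.inl i)) (Sum.inl_injective.comp Sum.inl_injective)
  have hYX : (fromBlocks Y 1 1 X).PosDef :=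
    hpos.submatrix (e := fun i => Sum.inr (Sum.inl i)) (Sum.inr_injective.comp Sum.inl_injective)
  have hX : X.IsSymm := congrArg toBlocks₁₁ (posDef_real_iff.1 hXY).1
  have hVTu : IsUnit VT := hVT ▸ (isUnit_nonsing_inv_iff.2 hU).mul (isUnit_one_sub_mul hXY)
  have hUV : X * Y + U * VT = 1 := by
    rw [hVT, mul_nonsing_inv_cancel_left _ _ ((isUnit_iff_isUnit_det _).1 hU), add_sub_cancel]
  obtain ⟨P, hP, hpart⟩ := exists_isStoragePartition hX hYX hVTu hUV
  exact ⟨hVTu, P, hP, (posDef_matPi_iff hu hL1 hXs hpart hVTu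
    (isControllerTransform_of_eq hU hVTu hBc hCc hAc)).1 hpos⟩

end Equivalence

end DDSynth

open DDSynth in
theorem theorem1_general {l p m q md N n pc pz pzt pt r : ℕ}
    (Bd0 : Matrix (Fin p) (Fin md) ℝ) (hBd0 : Bd0.rank = md)
    (Φ : Matrix (Fin md ⊕ Fin N) (Fin md ⊕ Fin N) ℝ) (hΦ : Φ.IsSymm)
    (hΦ22 : (-Φ.toBlocks₂₂).PosDef) (Yd : Matrix (Fin p) (Fin N) ℝ)
    (Xd : Matrix (Fin n) (Fin N) ℝ) (Ud : Matrix (Fin m) (Fin N) ℝ)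
    (Wd : Matrix (Fin q) (Fin N) ℝ)
    (hRank : (fromRows Xd (fromRows Ud Wd)).rank = n + m + q)
    (Xs : Matrix (StateIdx l p m q) (Fin n) ℝ) (hXs : LinearIndependent ℝ Xs.toRows₁.row)
    (C : Matrix (Fin pc) (Fin n) ℝ) (C1 : Matrix (Fin pz) (Fin n) ℝ)
    (E : Matrix (Fin pz) (Fin m) ℝ) (D1 : Matrix (Fin pz) (Fin q) ℝ)
    (Q : Matrix (Fin q) (Fin q) ℝ) (S : Matrix (Fin q) (Fin pz) ℝ)
    (T : Matrix (Fin pz) (Fin pzt) ℝ) (Rt : Matrix (Fin pzt) (Fin pzt) ℝ) (hRt : Rt.PosDef)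
    (H : Matrix (Fin p ⊕ (Fin n ⊕ (Fin m ⊕ Fin q))) (Fin p ⊕ (Fin n ⊕ (Fin m ⊕ Fin q))) ℝ)
    (hH : H = matH Bd0 Φ Yd Xd Ud Wd)
    (Ξ : Matrix (Fin p) (Fin pt) ℝ) (Λ : Matrix (Fin pt) (Fin pt) ℝ) (hΛ : Λ.PosDef)
    (hΞΛ : (colCenter H)ᵀ * H * colCenter H = Ξ * Λ * Ξᵀ)
    (L1 : Matrix (Fin r) (Fin n) ℝ) (hL1 : RowsBasisOfKer L1 Xs.toRows₁) :
    ((∃ (Ac : Matrix (Fin n) (Fin n) ℝ) (Bc : Matrix (Fin n) (Fin pc) ℝ)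
        (Cc : Matrix (Fin m) (Fin n) ℝ) (Dc : Matrix (Fin m) (Fin pc) ℝ)
        (P : Matrix (Fin n ⊕ Fin n) (Fin n ⊕ Fin n) ℝ),
        RobustDissipative Xs (consistentSet Bd0 Φ Yd Xd Ud Wd) C C1 E D1 Q S (T * Rt * Tᵀ)
          Ac Bc Cc Dc P) ↔
      (∃ (α : ℝ) (X Y Act : Matrix (Fin n) (Fin n) ℝ) (Bct : Matrix (Fin n) (Fin pc) ℝ)
        (Cct : Matrix (Fin m) (Fin n) ℝ) (Dc : Matrix (Fin m) (Fin pc) ℝ),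
        X.IsSymm ∧ Y.IsSymm ∧
        (matPi Xs H L1 Ξ Λ C C1 E D1 Q S T Rt α X Y Act Bct Cct Dc).PosDef)) ∧
    (∀ (α : ℝ) (X Y Act : Matrix (Fin n) (Fin n) ℝ) (Bct : Matrix (Fin n) (Fin pc) ℝ)
      (Cct : Matrix (Fin m) (Fin n) ℝ) (Dc : Matrix (Fin m) (Fin pc) ℝ),
      (matPi Xs H L1 Ξ Λ C C1 E D1 Q S T Rt α X Y Act Bct Cct Dc).PosDef →
      ∀ U : Matrix (Fin n) (Fin n) ℝ, IsUnit U →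
      ∀ (VT Ac : Matrix (Fin n) (Fin n) ℝ) (Bc : Matrix (Fin n) (Fin pc) ℝ)
        (Cc : Matrix (Fin m) (Fin n) ℝ),
        VT = U⁻¹ * (1 - X * Y) →
        Bc = U⁻¹ * (Bct - X * redB Xs (checkBu0 H) * Dc) →
        Cc = (Cct - Dc * C * Y) * VT⁻¹ →
        Ac = U⁻¹ * (Act - X * (redA Xs (checkAs H) * Y + redB Xs (checkBu0 H) * Cct)
            - U * Bc * C * Y) * VT⁻¹ →
        IsUnit VT ∧ ∃ P : Matrix (Fin n ⊕ Fin n) (Fin n ⊕ Fin n) ℝ,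
          RobustDissipative Xs (consistentSet Bd0 Φ Yd Xd Ud Wd) C C1 E D1 Q S (T * Rt * Tᵀ)
            Ac Bc Cc Dc P) := by
  have hN : (-H.toBlocks₂₂).PosDef := hH ▸ posDef_neg_matH_toBlocks₂₂ hΦ22 hRank
  have hu : IsUnit H.toBlocks₂₂ := by simpa using hN.isUnit.neg
  have hiff {Ac Bc Cc Dc P} := robustDissipative_iff (Xs := Xs) (C := C) (C1 := C1) (E := E)
    (D1 := D1) (Q := Q) (S := S) (T := T) (Ac := Ac) (Bc := Bc) (Cc := Cc) (Dc := Dc)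
    hBd0 hΦ hΦ22 hRank hH hRt hΛ hΞΛ P
  refine ⟨⟨?_, ?_⟩, ?_⟩
  · rintro ⟨Ac, Bc, Cc, Dc, P, hdiss⟩
    obtain ⟨hP, α, hLMI⟩ := hiff.1 hdiss
    obtain ⟨X, Y, Act, Bct, Cct, hpos⟩ :=
      exists_posDef_matPi_of_posDef_closedLoopLMI hu hL1 hXs hP hLMI
    exact ⟨α, X, Y, Act, Bct, Cct, Dc, hpos⟩
  · rintro ⟨α, X, Y, Act, Bct, Cct, Dc, -, -, hpos⟩
    obtain ⟨-, P, hP, hLMI⟩ :=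
      exists_posDef_closedLoopLMI_of_posDef_matPi hu hL1 hXs hpos isUnit_one rfl rfl rfl rfl
    exact ⟨_, _, _, Dc, P, hiff.2 ⟨hP, α, hLMI⟩⟩
  · intro α X Y Act Bct Cct Dc hpos U hU VT Ac Bc Cc hVT hBc hCc hAc
    obtain ⟨hVTu, P, hP, hLMI⟩ :=
      exists_posDef_closedLoopLMI_of_posDef_matPi hu hL1 hXs hpos hU hVT hBc hCc hAc
    exact ⟨hVTu, P, hiff.2 ⟨hP, α, hLMI⟩⟩

open DDSynth in
theorem theorem1 {l p m q md N n pc pz pzt pt r : ℕ} (hl : 1 ≤ l)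
    -- the plant and one recorded trajectory, generated by the plant on the times `0, …, N-1`
    (M : ARModel p m q md) (hBd0 : M.Bd0.rank = md)
    (s : Signals p m q md) (hs : ∀ t : ℕ, t < N → M.HoldsAt l s t)
    -- the state stays in the column space of the data; first `p` rows of `X` independent
    (hStay : StateStaysInData M l N s)
    (hRows : LinearIndependent ℝ (dataX l N s).toRows₁.row)
    -- the noise bound
    (Φ : Matrix (Fin md ⊕ Fin N) (Fin md ⊕ Fin N) ℝ) (hΦ : Φ.IsSymm)
    (hΦ22 : (-Φ.toBlocks₂₂).PosDef) (hNoise : NoiseBound Φ (dataD N s))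
    -- compact SVD `X = X_s diag(σ) X_rᵀ` and `X_d = diag(σ) X_rᵀ`
    (Xs : Matrix (StateIdx l p m q) (Fin n) ℝ) (σ : Fin n → ℝ) (Xr : Matrix (Fin N) (Fin n) ℝ)
    (hSVD : IsCompactSVD (dataX l N s) Xs σ Xr)
    (Xd : Matrix (Fin n) (Fin N) ℝ) (hXd : Xd = Matrix.diagonal σ * Xrᵀ)
    -- the set of consistent triples
    (Sig : Set (Matrix (Fin p) (Fin n) ℝ × Matrix (Fin p) (Fin m) ℝ × Matrix (Fin p) (Fin q) ℝ))
    (hSig : Sig = consistentSet M.Bd0 Φ (dataY N s) Xd (dataU N s) (dataW N s))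
    (hNonempty : Sig.Nonempty)
    (hRank : (fromRows Xd (fromRows (dataU N s) (dataW N s))).rank = n + m + q)
    -- performance output, measured output, supply rate
    (C1h : Matrix (Fin pz) (StateIdx l p m q) ℝ) (E : Matrix (Fin pz) (Fin m) ℝ)
    (D1 : Matrix (Fin pz) (Fin q) ℝ) (Ch : Matrix (Fin pc) (StateIdx l p m q) ℝ)
    (C1 : Matrix (Fin pz) (Fin n) ℝ) (hC1 : C1 = C1h * Xs)
    (C : Matrix (Fin pc) (Fin n) ℝ) (hC : C = Ch * Xs)
    (Q : Matrix (Fin q) (Fin q) ℝ) (hQ : Q.IsSymm) (S : Matrix (Fin q) (Fin pz) ℝ)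
    (R : Matrix (Fin pz) (Fin pz) ℝ) (hR : R.PosSemidef)
    (T : Matrix (Fin pz) (Fin pzt) ℝ) (Rt : Matrix (Fin pzt) (Fin pzt) ℝ) (hRt : Rt.PosDef)
    (hRfac : R = T * Rt * Tᵀ)
    -- auxiliary matrices entering `Π`
    (H : Matrix (Fin p ⊕ (Fin n ⊕ (Fin m ⊕ Fin q))) (Fin p ⊕ (Fin n ⊕ (Fin m ⊕ Fin q))) ℝ)
    (hH : H = matH M.Bd0 Φ (dataY N s) Xd (dataU N s) (dataW N s))
    (Ξ : Matrix (Fin p) (Fin pt) ℝ) (Λ : Matrix (Fin pt) (Fin pt) ℝ) (hΛ : Λ.PosDef)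
    (hΞΛ : (colCenter H)ᵀ * H * colCenter H = Ξ * Λ * Ξᵀ)
    (L1 : Matrix (Fin r) (Fin n) ℝ) (hL1 : RowsBasisOfKer L1 Xs.toRows₁) :
    -- the two statements are equivalent
    ((∃ (Ac : Matrix (Fin n) (Fin n) ℝ) (Bc : Matrix (Fin n) (Fin pc) ℝ)
        (Cc : Matrix (Fin m) (Fin n) ℝ) (Dc : Matrix (Fin m) (Fin pc) ℝ)
        (P : Matrix (Fin n ⊕ Fin n) (Fin n ⊕ Fin n) ℝ),
        RobustDissipative Xs Sig C C1 E D1 Q S R Ac Bc Cc Dc P) ↔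
      (∃ (α : ℝ) (X Y Act : Matrix (Fin n) (Fin n) ℝ) (Bct : Matrix (Fin n) (Fin pc) ℝ)
        (Cct : Matrix (Fin m) (Fin n) ℝ) (Dc : Matrix (Fin m) (Fin pc) ℝ),
        X.IsSymm ∧ Y.IsSymm ∧
        (matPi Xs H L1 Ξ Λ C C1 E D1 Q S T Rt α X Y Act Bct Cct Dc).PosDef)) ∧
    -- reconstruction of a controller from any solution and any invertible `U`
    (∀ (α : ℝ) (X Y Act : Matrix (Fin n) (Fin n) ℝ) (Bct : Matrix (Fin n) (Fin pc) ℝ)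
      (Cct : Matrix (Fin m) (Fin n) ℝ) (Dc : Matrix (Fin m) (Fin pc) ℝ),
      X.IsSymm → Y.IsSymm →
      (matPi Xs H L1 Ξ Λ C C1 E D1 Q S T Rt α X Y Act Bct Cct Dc).PosDef →
      ∀ U : Matrix (Fin n) (Fin n) ℝ, IsUnit U →
      ∀ (VT Ac : Matrix (Fin n) (Fin n) ℝ) (Bc : Matrix (Fin n) (Fin pc) ℝ)
        (Cc : Matrix (Fin m) (Fin n) ℝ),
        VT = U⁻¹ * (1 - X * Y) →
        Bc = U⁻¹ * (Bct - X * redB Xs (checkBu0 H) * Dc) →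
        Cc = (Cct - Dc * C * Y) * VT⁻¹ →
        Ac = U⁻¹ * (Act - X * (redA Xs (checkAs H) * Y + redB Xs (checkBu0 H) * Cct)
            - U * Bc * C * Y) * VT⁻¹ →
        IsUnit VT ∧ ∃ P : Matrix (Fin n ⊕ Fin n) (Fin n ⊕ Fin n) ℝ,
          RobustDissipative Xs Sig C C1 E D1 Q S R Ac Bc Cc Dc P) := by
  subst hSig hRfac
  obtain ⟨hiff, hcontroller⟩ := theorem1_general M.Bd0 hBd0 Φ hΦ hΦ22 _ Xd _ _ hRank Xs
    (linearIndependent_toRows₁_row_of_isCompactSVD hSVD hRows) C C1 E D1 Q S T Rt hRt H hH Ξ Λ hΛ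
    hΞΛ L1 hL1
  exact ⟨hiff, fun α X Y Act Bct Cct Dc _ _ => hcontroller α X Y Act Bct Cct Dc⟩
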